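/- Let $\mathcal V=(\mathcal V_0,\otimes,I)$ be a symmetric monoidal closed category whose underlying category $\mathcal V_0$ is complete and cocomplete, and let $J:\mathcal A\to\mathcal B$ be a $\mathcal V$-functor between small $\mathcal V$-categories. Write $\mathcal V\text{-}\mathbf{Cat}$ for the 2-category of small $\mathcal V$-categories, $\mathcal V$-functors and $\mathcal V$-natural transformations. For a small $\mathcal V$-category $\mathcal A$ and a possibly large $\mathcal V$-category $\mathcal C$, write $\mathcal V\text{-}\mathbf{Cat}(\mathcal A,\mathcal C)$ for the ordinary category of $\mathcal V$-functors $\mathcal A\to\mathcal C$ and $\mathcal V$-natural transformations, and $\mathcal V\text{-}\mathbf{Cat}[\mathcal A,\mathcal C]$ for the $\mathcal V$-category of $\mathcal V$-functors $\mathcal A\to\mathcal C$, with hom-objects the ends $\int_{a\in\mathcal A}\mathcal C(Fa,Ga)$. Precomposition with $J$ gives a functor $\mathcal V\text{-}\mathbf{Cat}(J,\mathcal C):\mathcal V\text{-}\mathbf{Cat}(\mathcal B,\mathcal C)\to\mathcal V\text{-}\mathbf{Cat}(\mathcal A,\mathcal C)$ and a $\mathcal V$-functor $\mathcal V\text{-}\mathbf{Cat}[J,\mathcal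 C]:\mathcal V\text{-}\mathbf{Cat}[\mathcal B,\mathcal C]\to\mathcal V\text{-}\mathbf{Cat}[\mathcal A,\mathcal C]$. A $\mathcal V$-functor $P:\mathcal X\to\mathcal Y$ is $\mathcal V$-fully faithful if all the morphisms $P_{X,X'}:\mathcal X(X,X')\to\mathcal Y(PX,PX')$ of $\mathcal V_0$ are isomorphisms. For $F:\mathcal A\to\mathcal V$, $\mathrm{Lan}_JF:\mathcal B\to\mathcal V$ denotes the left Kan extension, $(\mathrm{Lan}_JF)(b)=\int^{a\in\mathcal A}F(a)\otimes\mathcal B(Ja,b)$. The following conditions are equivalent: (a) $J$ is a $\mathcal V$-lax epimorphism, that is, $\mathcal V\text{-}\mathbf{Cat}[J,\mathcal C]$ is $\mathcal V$-fully faithful for every small $\mathcal V$-category $\mathcal C$; (b) $J$ is a lax epimorphism in the 2-category $\mathcal V\text{-}\mathbf{Cat}$, that is, the functor $\mathcal V\text{-}\mathbf{Cat}(J,\mathcal C)$ is fully faithful for every small $\mathcal V$-category $\mathcal C$; (c) the functor $\mathcal V\text{-}\mathbf{Cat}(J,\mathcal V):\mathcal V\text{-}\mathbf{Cat}(\mathcal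 B,\mathcal V)\to\mathcal V\text{-}\mathbf{Cat}(\mathcal A,\mathcal V)$ is fully faithful; (d) the $\mathcal V$-functor $\mathcal V\text{-}\mathbf{Cat}[J,\mathcal V]:\mathcal V\text{-}\mathbf{Cat}[\mathcal B,\mathcal V]\to\mathcal V\text{-}\mathbf{Cat}[\mathcal A,\mathcal V]$ is $\mathcal V$-fully faithful; (e) there is an isomorphism $\mathrm{Lan}_J\,\mathcal B(B,J-)\cong\mathcal B(B,-)$, $\mathcal V$-natural in $B\in\mathcal B^{\mathrm{op}}$ (an isomorphism of $\mathcal V$-functors $\mathcal B^{\mathrm{op}}\to\mathcal V\text{-}\mathbf{Cat}[\mathcal B,\mathcal V]$); (f) the $\mathcal V$-functor $\mathcal V\text{-}\mathbf{Cat}[J,\mathcal C]$ is $\mathcal V$-fully faithful for every, possibly large, $\mathcal V$-category $\mathcal C$. -/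

import Mathlib

open CategoryTheory MonoidalCategory BraidedCategory Limits
open scoped CategoryTheory.MonoidalClosed

universe w u u₁ u₂ u₃ u₄

noncomputable section

namespace EnrichedLaxEpi

section GeneralizedElements

variable (V : Type u) [Category.{w} V] [MonoidalCategory V]
variable {C : Type u₁} [EnrichedCategory V C] {D : Type u₂} [EnrichedCategory V D]

/-- The composite `X ⊗ Y ⟶ C(a, b) ⊗ C(b, c) ⟶ C(a, c)` of two generalized elements `x : X ⟶ C(a, b)`
and `y : Y ⟶ C(b, c)` of hom-objects of a `V`-category `C`. -/
def gcomp {a b c : C} {X Y : V} (x : X ⟶ (a ⟶[V] b)) (y : Y ⟶ (b ⟶[V] c)) :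
    X ⊗ Y ⟶ (a ⟶[V] c) :=
  (x ⊗ₘ y) ≫ eComp V a b c

theorem gcomp_assoc {a b c d : C} {X Y Z : V} (x : X ⟶ (a ⟶[V] b)) (y : Y ⟶ (b ⟶[V] c))
    (z : Z ⟶ (c ⟶[V] d)) :
    gcomp V (gcomp V x y) z = (α_ X Y Z).hom ≫ gcomp V x (gcomp V y z) := by
  simp only [gcomp]
  rw [← MonoidalCategory.tensorHom_comp_whiskerRight, ← MonoidalCategory.tensorHom_comp_whiskerLeft,
    Category.assoc, Category.assoc, ← e_assoc', associator_naturality_assoc]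

theorem gcomp_assoc' {a b c d : C} {X Y Z : V} (x : X ⟶ (a ⟶[V] b)) (y : Y ⟶ (b ⟶[V] c))
    (z : Z ⟶ (c ⟶[V] d)) :
    gcomp V x (gcomp V y z) = (α_ X Y Z).inv ≫ gcomp V (gcomp V x y) z := by
  rw [gcomp_assoc, Iso.inv_hom_id_assoc]

theorem gcomp_precomp {a b c : C} {X Y X' Y' : V} (f : X' ⟶ X) (g : Y' ⟶ Y)
    (x : X ⟶ (a ⟶[V] b)) (y : Y ⟶ (b ⟶[V] c)) :
    gcomp V (f ≫ x) (g ≫ y) = (f ⊗ₘ g) ≫ gcomp V x y := by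
  simp [gcomp]

theorem gcomp_precomp_left {a b c : C} {X Y X' : V} (f : X' ⟶ X)
    (x : X ⟶ (a ⟶[V] b)) (y : Y ⟶ (b ⟶[V] c)) :
    gcomp V (f ≫ x) y = f ▷ Y ≫ gcomp V x y := by
  rw [gcomp, gcomp, whiskerRight_comp_tensorHom_assoc]

theorem gcomp_precomp_right {a b c : C} {X Y Y' : V} (g : Y' ⟶ Y)
    (x : X ⟶ (a ⟶[V] b)) (y : Y ⟶ (b ⟶[V] c)) :
    gcomp V x (g ≫ y) = X ◁ g ≫ gcomp V x y := by
  rw [gcomp, gcomp, whiskerLeft_comp_tensorHom_assoc]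

theorem gcomp_eId_left {a b : C} {X : V} (x : X ⟶ (a ⟶[V] b)) :
    gcomp V (eId V a) x = (λ_ X).hom ≫ x := by
  rw [gcomp, tensorHom_def', Category.assoc, ← cancel_epi (λ_ X).inv]
  simp

theorem gcomp_eId_right {a b : C} {X : V} (x : X ⟶ (a ⟶[V] b)) :
    gcomp V x (eId V b) = (ρ_ X).hom ≫ x := by
  rw [gcomp, MonoidalCategory.tensorHom_def, Category.assoc, ← cancel_epi (ρ_ X).inv]
  simp

theorem eComp_eq_gcomp (a b c : C) :
    gcomp V (𝟙 (a ⟶[V] b)) (𝟙 (b ⟶[V] c)) = eComp V a b c := by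
  simp [gcomp]

theorem gcomp_map (F : EnrichedFunctor V C D) {a b c : C} {X Y : V} (x : X ⟶ (a ⟶[V] b))
    (y : Y ⟶ (b ⟶[V] c)) :
    gcomp V x y ≫ F.map a c = gcomp V (x ≫ F.map a b) (y ≫ F.map b c) := by
  simp [gcomp]

end GeneralizedElements

section VFunctors

variable (V : Type u) [Category.{w} V] [MonoidalCategory V]

/-- The type of `V`-functors `C ⥤ D`. It carries the ordinary category `V-Cat(C, D)` of `V`-functors
and `V`-natural transformations and, if `C` is small and `V` complete, the `V`-category
`V-Cat[C, D]`. (It is kept apart from `EnrichedFunctor V C D` because Mathlib's category structure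
on the latter takes as morphisms the transformations that are natural for the underlying ordinary
functors, which is weaker than `V`-naturality in general.) -/
structure VFun (C : Type u₁) [EnrichedCategory V C] (D : Type u₂) [EnrichedCategory V D] extends
    EnrichedFunctor V C D

variable {V}
variable {C : Type u₁} [EnrichedCategory V C] {D : Type u₂} [EnrichedCategory V D]
  {E : Type u₃} [EnrichedCategory V E]

namespace VFun

/-- A `V`-functor is `V`-fully faithful if its actions on hom-objects are isomorphisms. -/
def IsVFullyFaithful (F : VFun V C D) : Prop := ∀ a b : C, IsIso (F.map a b)

theorem gcomp_map (F : VFun V C D) {a b c : C} {X Y : V} (x : X ⟶ (a ⟶[V] b))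
    (y : Y ⟶ (b ⟶[V] c)) :
    gcomp V x y ≫ F.map a c = gcomp V (x ≫ F.map a b) (y ≫ F.map b c) := by
  simp [gcomp]

variable (V) in
/-- The identity `V`-functor. -/
abbrev id (C : Type u₁) [EnrichedCategory V C] : VFun V C C where
  obj a := a
  map _ _ := 𝟙 _

/-- The composite of `V`-functors, in diagrammatic order. -/
abbrev comp (F : VFun V C D) (G : VFun V D E) : VFun V C E where
  obj a := G.obj (F.obj a)
  map a b := F.map a b ≫ G.map (F.obj a) (F.obj b)

end VFun

/-- A `V`-natural transformation `F ⟶ G`: a family `app a : I ⟶ D(F a, G a)` for which the two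
composites `C(a, b) ⟶ D(F a, G b)`, through `I ⊗ C(a, b)` and through `C(a, b) ⊗ I`, agree. -/
@[ext]
structure VNatTrans (F G : VFun V C D) where
  /-- the components -/
  app (a : C) : 𝟙_ V ⟶ (F.obj a ⟶[V] G.obj a)
  /-- `V`-naturality -/
  naturality (a b : C) :
    (λ_ (a ⟶[V] b)).inv ≫ gcomp V (app a) (G.map a b) =
      (ρ_ (a ⟶[V] b)).inv ≫ gcomp V (F.map a b) (app b)

namespace VNatTrans

/-- The identity `V`-natural transformation. -/
def id (F : VFun V C D) : VNatTrans F F where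
  app a := eId V (F.obj a)
  naturality a b := by simp [gcomp_eId_left, gcomp_eId_right]

/-- The vertical composite of `V`-natural transformations. -/
def comp {F G H : VFun V C D} (α : VNatTrans F G) (β : VNatTrans G H) : VNatTrans F H where
  app a := (λ_ (𝟙_ V)).inv ≫ gcomp V (α.app a) (β.app a)
  naturality a b := by
    have hα := α.naturality a b
    have hβ := β.naturality a b
    rw [Iso.inv_comp_eq] at hα hβ
    rw [gcomp_precomp_left, gcomp_precomp_right, gcomp_assoc, hβ, gcomp_precomp_right,
      gcomp_precomp_right, gcomp_assoc', hα, gcomp_precomp_left, gcomp_precomp_left, gcomp_assoc']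
    monoidal

end VNatTrans

namespace VFun

/-- The ordinary category `V-Cat(C, D)` of `V`-functors and `V`-natural transformations. -/
instance : Category (VFun V C D) where
  Hom F G := VNatTrans F G
  id F := VNatTrans.id F
  comp α β := VNatTrans.comp α β
  id_comp α := by
    ext a
    simp [VNatTrans.comp, VNatTrans.id, gcomp_eId_left]
  comp_id α := by
    ext a
    simp [VNatTrans.comp, VNatTrans.id, gcomp_eId_right, ← MonoidalCategory.unitors_equal]
  assoc α β γ := by
    ext a
    simp only [VNatTrans.comp, gcomp_precomp_left, gcomp_precomp_right, gcomp_assoc]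
    monoidal

@[ext]
theorem hom_ext {F G : VFun V C D} {α β : F ⟶ G}
    (h : ∀ a, VNatTrans.app α a = VNatTrans.app β a) : α = β :=
  VNatTrans.ext (funext h)

theorem id_app (F : VFun V C D) (a : C) : VNatTrans.app (𝟙 F) a = eId V (F.obj a) := rfl

theorem comp_app {F G H : VFun V C D} (α : F ⟶ G) (β : G ⟶ H) (a : C) :
    VNatTrans.app (α ≫ β) a =
      (λ_ (𝟙_ V)).inv ≫ gcomp V (VNatTrans.app α a) (VNatTrans.app β a) := rfl

theorem eqToHom_app {F G : VFun V C D} (h : F = G) (a : C) :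
    VNatTrans.app (eqToHom h) a =
      eId V (F.obj a) ≫ eqToHom (congrArg (fun K : VFun V C D => (F.obj a ⟶[V] K.obj a)) h) := by
  subst h
  simp [id_app]

/-- Whiskering of a `V`-natural transformation with a `V`-functor applied before it. -/
def whiskerLeft (F : VFun V C D) {G H : VFun V D E} (α : G ⟶ H) : F.comp G ⟶ F.comp H where
  app a := VNatTrans.app α (F.obj a)
  naturality a b := by
    have h := VNatTrans.naturality α (F.obj a) (F.obj b)
    rw [Iso.inv_comp_eq] at h
    rw [gcomp_precomp_left, gcomp_precomp_right, h]
    simp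

/-- Whiskering of a `V`-natural transformation with a `V`-functor applied after it. -/
def whiskerRight {F G : VFun V C D} (α : F ⟶ G) (H : VFun V D E) : F.comp H ⟶ G.comp H where
  app a := VNatTrans.app α a ≫ H.map _ _
  naturality a b := by
    rw [← H.gcomp_map, ← H.gcomp_map, reassoc_of% (VNatTrans.naturality α a b)]

/-- The ordinary functor `V-Cat(J, E) : V-Cat(D, E) ⥤ V-Cat(C, E)`, precomposition with `J`. -/
def precomp (J : VFun V C D) (E : Type u₃) [EnrichedCategory V E] :
    VFun V D E ⥤ VFun V C E where
  obj F := J.comp F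
  map α := J.whiskerLeft α

/-- The isomorphism `id ⋙ F ≅ F`, with identity components. -/
def leftUnitor (F : VFun V C D) : (VFun.id V C).comp F ≅ F where
  hom := { app := fun a => eId V (F.obj a)
           naturality := by simp [gcomp_eId_left, gcomp_eId_right] }
  inv := { app := fun a => eId V (F.obj a)
           naturality := by simp [gcomp_eId_left, gcomp_eId_right] }
  hom_inv_id := by ext a; simp [comp_app, id_app, gcomp_eId_left]
  inv_hom_id := by ext a; simp [comp_app, id_app, gcomp_eId_left]

/-- The isomorphism `F ⋙ id ≅ F`, with identity components. -/
def rightUnitor (F : VFun V C D) : F.comp (VFun.id V D) ≅ F where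
  hom := { app := fun a => eId V (F.obj a)
           naturality := by simp [gcomp_eId_left, gcomp_eId_right] }
  inv := { app := fun a => eId V (F.obj a)
           naturality := by simp [gcomp_eId_left, gcomp_eId_right] }
  hom_inv_id := by ext a; simp [comp_app, id_app, gcomp_eId_left]
  inv_hom_id := by ext a; simp [comp_app, id_app, gcomp_eId_left]

/-- The isomorphism `(F ⋙ G) ⋙ H ≅ F ⋙ (G ⋙ H)`, with identity components. -/
def associator {E' : Type u₄} [EnrichedCategory V E'] (F : VFun V C D) (G : VFun V D E)
    (H : VFun V E E') : (F.comp G).comp H ≅ F.comp (G.comp H) where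
  hom := { app := fun a => eId V (H.obj (G.obj (F.obj a)))
           naturality := by simp [gcomp_eId_left, gcomp_eId_right] }
  inv := { app := fun a => eId V (H.obj (G.obj (F.obj a)))
           naturality := by simp [gcomp_eId_left, gcomp_eId_right] }
  hom_inv_id := by ext a; simp [comp_app, id_app, gcomp_eId_left]
  inv_hom_id := by ext a; simp [comp_app, id_app, gcomp_eId_left]

theorem id_comp_eq (F : VFun V C D) : (VFun.id V C).comp F = F := by
  cases F
  simp [comp]

theorem comp_id_eq (F : VFun V C D) : F.comp (VFun.id V D) = F := by
  cases F
  simp [comp]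

theorem comp_assoc_eq {E' : Type u₄} [EnrichedCategory V E'] (F : VFun V C D) (G : VFun V D E)
    (H : VFun V E E') : (F.comp G).comp H = F.comp (G.comp H) := by
  simp [comp]

theorem leftUnitor_eq (F : VFun V C D) : leftUnitor F = eqToIso (id_comp_eq F) := by
  ext a
  simp [eqToHom_app, leftUnitor]

theorem rightUnitor_eq (F : VFun V C D) : rightUnitor F = eqToIso (comp_id_eq F) := by
  ext a
  simp [eqToHom_app, rightUnitor]

theorem associator_eq {E' : Type u₄} [EnrichedCategory V E'] (F : VFun V C D) (G : VFun V D E)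
    (H : VFun V E E') : associator F G H = eqToIso (comp_assoc_eq F G H) := by
  ext a
  simp [eqToHom_app, associator]

end VFun

end VFunctors

section TwoCategory

/-- A 1-cell `f : A ⟶ B` of a 2-category is a lax epimorphism if for every object `C` the functor
`(B ⟶ C) ⥤ (A ⟶ C)` given by precomposition with `f` is fully faithful. -/
def IsLaxEpi {𝒜 : Type u₁} [Bicategory.{u₂, u₃} 𝒜] {A B : 𝒜} (f : A ⟶ B) : Prop :=
  ∀ C : 𝒜, (Bicategory.precomp C f).Full ∧ (Bicategory.precomp C f).Faithful

variable (V : Type u) [Category.{w} V] [MonoidalCategory V]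

/-- The type of small `V`-categories. -/
structure VCat where
  /-- the underlying type of objects -/
  carrier : Type w
  /-- the `V`-category structure -/
  [str : EnrichedCategory V carrier]

attribute [instance] VCat.str

variable {V}

/-- The 2-category `V-Cat` of small `V`-categories, `V`-functors and `V`-natural transformations. -/
instance : Bicategory (VCat.{w, u} V) where
  Hom C D := VFun V C.carrier D.carrier
  id C := VFun.id V C.carrier
  comp F G := F.comp G
  whiskerLeft F _ _ α := F.whiskerLeft α
  whiskerRight α H := VFun.whiskerRight α H
  associator F G H := VFun.associator F G H
  leftUnitor F := VFun.leftUnitor F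
  rightUnitor F := VFun.rightUnitor F
  whiskerLeft_id _ _ := rfl
  whiskerLeft_comp _ _ _ _ _ _ := rfl
  id_whiskerLeft η := by
    ext a
    simp [VFun.leftUnitor, VFun.comp_app, VFun.whiskerLeft, gcomp_eId_left, gcomp_eId_right, ← MonoidalCategory.unitors_equal]
  comp_whiskerLeft F G _ _ η := by
    ext a
    simp [VFun.associator, VFun.comp_app, VFun.whiskerLeft, gcomp_eId_left, gcomp_eId_right, ← MonoidalCategory.unitors_equal]
  id_whiskerRight F G := by
    ext a
    simp [VFun.id_app, VFun.whiskerRight]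
  comp_whiskerRight η θ H := by
    ext a
    simp [VFun.comp_app, VFun.whiskerRight, VFun.gcomp_map]
  whiskerRight_id η := by
    ext a
    simp [VFun.rightUnitor, VFun.comp_app, VFun.whiskerRight, gcomp_eId_left, gcomp_eId_right, ← MonoidalCategory.unitors_equal]
  whiskerRight_comp η G H := by
    ext a
    simp [VFun.associator, VFun.comp_app, VFun.whiskerRight, gcomp_eId_left, gcomp_eId_right, ← MonoidalCategory.unitors_equal]
  whisker_assoc F _ _ η H := by
    ext a
    simp [VFun.associator, VFun.comp_app, VFun.whiskerRight, VFun.whiskerLeft, gcomp_eId_left,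
      gcomp_eId_right, ← MonoidalCategory.unitors_equal]
  whisker_exchange η θ := by
    ext a
    rename_i f g _ _
    have h := VNatTrans.naturality θ (f.obj a) (g.obj a)
    rw [Iso.inv_comp_eq] at h
    simp only [VFun.comp_app, VFun.whiskerRight, VFun.whiskerLeft]
    rw [gcomp_precomp_right, h, gcomp_precomp_left]
    simp [← MonoidalCategory.unitors_equal]
  pentagon F G H K := by
    ext a
    simp [VFun.associator, VFun.comp_app, VFun.whiskerRight, VFun.whiskerLeft, gcomp_eId_right,
      ← MonoidalCategory.unitors_equal]
  triangle F G := by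
    ext a
    simp [VFun.associator, VFun.leftUnitor, VFun.rightUnitor, VFun.comp_app, VFun.whiskerRight,
      VFun.whiskerLeft, gcomp_eId_right, ← MonoidalCategory.unitors_equal]

instance : Bicategory.Strict (VCat.{w, u} V) where
  id_comp F := VFun.id_comp_eq F
  comp_id F := VFun.comp_id_eq F
  assoc F G H := VFun.comp_assoc_eq F G H
  leftUnitor_eqToIso F := VFun.leftUnitor_eq F
  rightUnitor_eqToIso F := VFun.rightUnitor_eq F
  associator_eqToIso F G H := VFun.associator_eq F G H

/-- The small `V`-category `A` as an object of the 2-category `V-Cat`. -/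
def VCat.of (V : Type u) [Category.{w} V] [MonoidalCategory V] (A : Type w)
    [EnrichedCategory V A] : VCat.{w, u} V where
  carrier := A

/-- A `V`-functor between small `V`-categories as a 1-cell of the 2-category `V-Cat`. -/
def VFun.toCell {A B : Type w} [EnrichedCategory V A] [EnrichedCategory V B] (J : VFun V A B) :
    VCat.of V A ⟶ VCat.of V B := J

end TwoCategory

section Wedges

variable {V : Type u} [Category.{w} V] [MonoidalCategory V] [SymmetricCategory V]
variable {A : Type u₁} [EnrichedCategory V A] {B : Type u₃} [EnrichedCategory V B]
  {C : Type u₂} [EnrichedCategory V C]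

/-- A family `f a : X ⟶ C(F a, G a)` is `V`-natural in `a` if for all `a`, `b` the two composites
`A(a, b) ⊗ X ⟶ C(F a, G b)`, through `F b` and (after the symmetry) through `G a`, agree. -/
def IsVWedge (F G : VFun V A C) {X : V} (f : ∀ a, X ⟶ (F.obj a ⟶[V] G.obj a)) : Prop :=
  ∀ a b, gcomp V (F.map a b) (f b) = (β_ (a ⟶[V] b) X).hom ≫ gcomp V (f a) (G.map a b)

theorem isVWedge_eId (F : VFun V A C) : IsVWedge F F fun a => eId V (F.obj a) := by
  intro a b
  simp [gcomp_eId_left, gcomp_eId_right, braiding_tensorUnit_right]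

theorem IsVWedge.gcomp {F G H : VFun V A C} {X Y : V} {f : ∀ a, X ⟶ (F.obj a ⟶[V] G.obj a)}
    {g : ∀ a, Y ⟶ (G.obj a ⟶[V] H.obj a)} (hf : IsVWedge F G f) (hg : IsVWedge G H g) :
    IsVWedge F H fun a => gcomp V (f a) (g a) := by
  intro a b
  rw [gcomp_assoc', hf, gcomp_precomp_left, gcomp_assoc, hg, gcomp_precomp_right, gcomp_assoc']
  simp [braiding_tensor_right_hom]

theorem IsVWedge.precomp {F G : VFun V A C} {X : V} {f : ∀ a, X ⟶ (F.obj a ⟶[V] G.obj a)}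
    (hf : IsVWedge F G f) (J : VFun V B A) :
    IsVWedge (J.comp F) (J.comp G) fun b => f (J.obj b) := by
  intro a b
  rw [gcomp_precomp_left, hf, gcomp_precomp_right, braiding_naturality_left_assoc]

end Wedges

section FunctorVCategory

variable {V : Type u} [Category.{w} V] [MonoidalCategory V] [SymmetricCategory V]
  [MonoidalClosed V] [HasLimits V]
variable {A : Type w} [EnrichedCategory V A] {C : Type u₂} [EnrichedCategory V C]

/-- The map `∏ₐ C(F a, G a) ⟶ ∏_{a, b} [A(a, b), C(F a, G b)]` induced by the action of `F`. -/
def natObjLeft (F G : VFun V A C) :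
    (∏ᶜ fun a : A => (F.obj a ⟶[V] G.obj a)) ⟶
      ∏ᶜ fun p : A × A => (ihom (p.1 ⟶[V] p.2)).obj (F.obj p.1 ⟶[V] G.obj p.2) :=
  Pi.lift fun p => MonoidalClosed.curry (gcomp V (F.map p.1 p.2) (Pi.π _ p.2))

/-- The map `∏ₐ C(F a, G a) ⟶ ∏_{a, b} [A(a, b), C(F a, G b)]` induced by the action of `G`. -/
def natObjRight (F G : VFun V A C) :
    (∏ᶜ fun a : A => (F.obj a ⟶[V] G.obj a)) ⟶
      ∏ᶜ fun p : A × A => (ihom (p.1 ⟶[V] p.2)).obj (F.obj p.1 ⟶[V] G.obj p.2) :=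
  Pi.lift fun p => MonoidalClosed.curry
    ((β_ (p.1 ⟶[V] p.2) _).hom ≫ gcomp V (Pi.π _ p.1) (G.map p.1 p.2))

/-- The object `∫ₐ C(F a, G a)` of `V`-natural transformations from `F` to `G`, as the equalizer
of the two maps above. -/
def natObj (F G : VFun V A C) : V := equalizer (natObjLeft F G) (natObjRight F G)

namespace natObj

/-- The projections of the end. -/
def π (F G : VFun V A C) (a : A) : natObj F G ⟶ (F.obj a ⟶[V] G.obj a) :=
  equalizer.ι (natObjLeft F G) (natObjRight F G) ≫ Pi.π _ a

theorem isVWedge_iff (F G : VFun V A C) {X : V} (g : X ⟶ ∏ᶜ fun a : A => (F.obj a ⟶[V] G.obj a)) :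
    IsVWedge F G (fun a => g ≫ Pi.π _ a) ↔ g ≫ natObjLeft F G = g ≫ natObjRight F G := by
  have key : ∀ a b : A,
      gcomp V (F.map a b) (g ≫ Pi.π _ b) =
          (β_ (a ⟶[V] b) X).hom ≫ gcomp V (g ≫ Pi.π _ a) (G.map a b) ↔
        (g ≫ natObjLeft F G) ≫ Pi.π _ (a, b) = (g ≫ natObjRight F G) ≫ Pi.π _ (a, b) := by
    intro a b
    rw [Category.assoc, Category.assoc, natObjLeft, natObjRight, Pi.lift_π, Pi.lift_π,
      ← MonoidalClosed.curry_natural_left, ← MonoidalClosed.curry_natural_left,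
      MonoidalClosed.curry_injective.eq_iff, gcomp_precomp_right, gcomp_precomp_left,
      braiding_naturality_right_assoc]
  constructor
  · intro h
    apply Pi.hom_ext
    rintro ⟨a, b⟩
    exact (key a b).1 (h a b)
  · intro h a b
    exact (key a b).2 (by rw [h])

theorem isVWedge_π (F G : VFun V A C) : IsVWedge F G (π F G) :=
  (isVWedge_iff F G _).2 (equalizer.condition _ _)

/-- The universal property of the end: a `V`-natural family factors through it. -/
def lift {F G : VFun V A C} {X : V} (f : ∀ a, X ⟶ (F.obj a ⟶[V] G.obj a))
    (hf : IsVWedge F G f) : X ⟶ natObj F G :=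
  equalizer.lift (Pi.lift f) ((isVWedge_iff F G _).1 (by simpa using hf))

theorem lift_π {F G : VFun V A C} {X : V} (f : ∀ a, X ⟶ (F.obj a ⟶[V] G.obj a))
    (hf : IsVWedge F G f) (a : A) : lift f hf ≫ π F G a = f a :=
  (Category.assoc _ _ _).symm.trans ((eq_whisker (equalizer.lift_ι (Pi.lift f) _) _).trans
    (Pi.lift_π f a))

theorem hom_ext {F G : VFun V A C} {X : V} {f g : X ⟶ natObj F G}
    (h : ∀ a, f ≫ π F G a = g ≫ π F G a) : f = g := by
  apply equalizer.hom_ext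
  apply Pi.hom_ext
  intro a
  exact (Category.assoc _ _ _).trans ((h a).trans (Category.assoc _ _ _).symm)

end natObj

/-- The `V`-category `V-Cat[A, C]` of `V`-functors, for `A` small. -/
instance : EnrichedCategory V (VFun V A C) where
  Hom F G := natObj F G
  id F := natObj.lift (fun a => eId V (F.obj a)) (isVWedge_eId F)
  comp F G H := natObj.lift (fun a => gcomp V (natObj.π F G a) (natObj.π G H a))
    ((natObj.isVWedge_π F G).gcomp (natObj.isVWedge_π G H))
  id_comp F G := by
    apply natObj.hom_ext
    intro a
    simp [natObj.lift_π, ← gcomp_precomp_left, gcomp_eId_left]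
  comp_id F G := by
    apply natObj.hom_ext
    intro a
    simp [natObj.lift_π, ← gcomp_precomp_right, gcomp_eId_right]
  assoc F G H K := by
    apply natObj.hom_ext
    intro a
    simp [natObj.lift_π, ← gcomp_precomp_right, ← gcomp_precomp_left, gcomp_assoc]

namespace VFun

/-- Evaluation at `a` on hom-objects: the projection `[A, C](F, G) ⟶ C(F a, G a)`. -/
def ev (F G : VFun V A C) (a : A) : (F ⟶[V] G) ⟶ (F.obj a ⟶[V] G.obj a) := natObj.π F G a

/-- The morphism into the hom-object `[A, C](F, G)` given by a `V`-natural family. -/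
def lift {F G : VFun V A C} {X : V} (f : ∀ a, X ⟶ (F.obj a ⟶[V] G.obj a))
    (hf : IsVWedge F G f) : X ⟶ (F ⟶[V] G) := natObj.lift f hf

@[simp]
theorem lift_ev {F G : VFun V A C} {X : V} (f : ∀ a, X ⟶ (F.obj a ⟶[V] G.obj a))
    (hf : IsVWedge F G f) (a : A) : lift f hf ≫ ev F G a = f a :=
  natObj.lift_π f hf a

theorem vHom_ext {F G : VFun V A C} {X : V} {f g : X ⟶ (F ⟶[V] G)}
    (h : ∀ a, f ≫ ev F G a = g ≫ ev F G a) : f = g :=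
  natObj.hom_ext h

theorem isVWedge_ev (F G : VFun V A C) : IsVWedge F G (ev F G) := natObj.isVWedge_π F G

theorem eId_ev (F : VFun V A C) (a : A) : eId V F ≫ ev F F a = eId V (F.obj a) :=
  natObj.lift_π _ (isVWedge_eId F) a

theorem eComp_ev (F G H : VFun V A C) (a : A) :
    eComp V F G H ≫ ev F H a = gcomp V (ev F G a) (ev G H a) :=
  natObj.lift_π _ ((natObj.isVWedge_π F G).gcomp (natObj.isVWedge_π G H)) a

theorem gcomp_ev {F G H : VFun V A C} {X Y : V} (x : X ⟶ (F ⟶[V] G)) (y : Y ⟶ (G ⟶[V] H)) (a : A) :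
    gcomp V x y ≫ ev F H a = gcomp V (x ≫ ev F G a) (y ≫ ev G H a) := by
  rw [gcomp, Category.assoc, eComp_ev, gcomp_precomp]

variable {B : Type w} [EnrichedCategory V B]

/-- The `V`-functor `V-Cat[J, C] : V-Cat[B, C] ⥤ V-Cat[A, C]`, precomposition with `J`. -/
def vPrecomp (J : VFun V A B) (C : Type u₂) [EnrichedCategory V C] :
    VFun V (VFun V B C) (VFun V A C) where
  obj F := J.comp F
  map F G := lift (F := J.comp F) (G := J.comp G) (fun a => ev F G (J.obj a))
    ((isVWedge_ev F G).precomp J)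
  map_id F := by
    apply vHom_ext
    intro a
    rw [Category.assoc, lift_ev, eId_ev, eId_ev]
  map_comp F G H := by
    apply vHom_ext
    intro a
    change _ = gcomp V _ _ ≫ _
    rw [gcomp_ev, lift_ev, lift_ev, Category.assoc, lift_ev, eComp_ev]

/-- `J` is a `V`-lax epimorphism if `V-Cat[J, C]` is `V`-fully faithful for every small
`V`-category `C`. -/
def IsVLaxEpi (J : VFun V A B) : Prop :=
  ∀ (C : Type w) [EnrichedCategory V C], (J.vPrecomp C).IsVFullyFaithful

end VFun

end FunctorVCategory

section SelfEnriched

variable {V : Type u} [Category.{w} V] [MonoidalCategory V] [MonoidalClosed V]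

/-- The morphism `a ⊗ X ⟶ b` corresponding to a generalized element `X ⟶ [a, b]` of a hom-object of
the `V`-category `V`. -/
def unc {a b X : V} (x : X ⟶ EnrichedCategory.Hom (V := V) a b) : a ⊗ X ⟶ b := MonoidalClosed.uncurry x

/-- The generalized element `X ⟶ [a, b]` of a hom-object of the `V`-category `V` corresponding to a
morphism `a ⊗ X ⟶ b`. -/
def cur {a b X : V} (f : a ⊗ X ⟶ b) : X ⟶ EnrichedCategory.Hom (V := V) a b := MonoidalClosed.curry f

@[simp]
theorem unc_cur {a b X : V} (f : a ⊗ X ⟶ b) : unc (cur f) = f := MonoidalClosed.uncurry_curry f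

theorem unc_injective {a b X : V} {x y : X ⟶ EnrichedCategory.Hom (V := V) a b} (h : unc x = unc y) : x = y :=
  MonoidalClosed.uncurry_injective h

theorem unc_precomp {a b X Y : V} (f : Y ⟶ X) (x : X ⟶ EnrichedCategory.Hom (V := V) a b) :
    unc (f ≫ x) = a ◁ f ≫ unc x := MonoidalClosed.uncurry_natural_left f x

theorem unc_eId (a : V) : unc (eId V a) = (ρ_ a).hom := MonoidalClosed.uncurry_curry (ρ_ a).hom

theorem unc_gcomp {a b c X Y : V} (x : X ⟶ EnrichedCategory.Hom (V := V) a b) (y : Y ⟶ EnrichedCategory.Hom (V := V) b c) :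
    unc (gcomp V x y) = (α_ a X Y).inv ≫ unc x ▷ Y ≫ unc y := by
  have h : unc (eComp V a b c) = (α_ _ _ _).inv ≫ unc (𝟙 _) ▷ _ ≫ unc (𝟙 _) := by
    refine (MonoidalClosed.uncurry_curry _).trans ?_
    have e : ∀ p q : V, unc (𝟙 (EnrichedCategory.Hom (V := V) p q)) = (ihom.ev p).app q :=
      fun p q => MonoidalClosed.uncurry_id_eq_ev p q
    rw [e, e]
    rfl
  rw [gcomp, unc_precomp, h]
  conv_rhs => rw [← Category.comp_id x, ← Category.comp_id y, unc_precomp, unc_precomp]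
  simp [MonoidalCategory.tensorHom_def, ← whisker_exchange_assoc]

end SelfEnriched

section ValuedInV

variable {V : Type u} [Category.{w} V] [MonoidalCategory V] [SymmetricCategory V]
  [MonoidalClosed V]

variable {A : Type u₁} [EnrichedCategory V A]

/-- The action `F a ⊗ A(a, a') ⟶ F a'` of a `V`-functor `F : A ⥤ V`. -/
def VFun.act (F : VFun V A V) (a a' : A) : F.obj a ⊗ (a ⟶[V] a') ⟶ F.obj a' := unc (F.map a a')

theorem VFun.act_unc {F G : VFun V A V} {X : V}
    {f : ∀ a, X ⟶ (EnrichedCategory.Hom (V := V) (F.obj a) (G.obj a))} (hf : IsVWedge F G f)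
    (a a' : A) :
    F.act a a' ▷ X ≫ unc (f a') =
      (α_ _ _ _).hom ≫ F.obj a ◁ (β_ (a ⟶[V] a') X).hom ≫ (α_ _ _ _).inv ≫
        unc (f a) ▷ (a ⟶[V] a') ≫ G.act a a' := by
  have h := congrArg unc (hf a a')
  rw [unc_precomp, unc_gcomp, unc_gcomp, Iso.inv_comp_eq] at h
  exact h

/-- The representable `V`-functor `B(b, -) : B ⥤ V`. -/
abbrev VFun.rep {B : Type u₁} [EnrichedCategory V B] (b : B) : VFun V B V where
  obj x := (b ⟶[V] x)
  map x y := cur (eComp V b x y)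
  map_id x := by
    apply unc_injective
    rw [unc_precomp, unc_cur, unc_eId, ← cancel_epi (ρ_ _).inv, e_comp_id, Iso.inv_hom_id]
  map_comp x y z := by
    apply unc_injective
    change _ = unc (gcomp V _ _)
    rw [unc_precomp, unc_gcomp, unc_cur, unc_cur, unc_cur, e_assoc]

theorem isVWedge_repMap {B : Type u₁} [EnrichedCategory V B] (b b' : B) : IsVWedge (VFun.rep (V := V) b) (VFun.rep (V := V) b')
    fun x => cur ((β_ (b ⟶[V] x) (b' ⟶[V] b)).hom ≫ eComp V b' b x) := by
  intro x y
  apply unc_injective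
  rw [unc_precomp, unc_gcomp, unc_gcomp, unc_cur, unc_cur, unc_cur, unc_cur,
    MonoidalCategory.comp_whiskerRight, Category.assoc, braiding_naturality_left_assoc]
  simp [braiding_tensor_left_hom, e_assoc']

variable [HasLimits V] {B : Type w} [EnrichedCategory V B]

/-- The action `B(b', b) ⟶ [B, V](B(b, -), B(b', -))` of the Yoneda embedding, whose component at
`x` corresponds to the composition `B(b', b) ⊗ B(b, x) ⟶ B(b', x)`. -/
def repMap (b b' : B) :
    (b' ⟶[V] b) ⟶ (VFun.rep (V := V) b ⟶[V] VFun.rep (V := V) b') :=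
  VFun.lift (F := VFun.rep b) (G := VFun.rep b')
    (fun x => cur ((β_ (b ⟶[V] x) (b' ⟶[V] b)).hom ≫ eComp V b' b x))
    (isVWedge_repMap b b')

theorem unc_repMap_ev (b b' x : B) :
    unc (repMap (V := V) b b' ≫ VFun.ev (VFun.rep b) (VFun.rep b') x) =
      (β_ (b ⟶[V] x) (b' ⟶[V] b)).hom ≫ eComp V b' b x := by
  rw [repMap, VFun.lift_ev, unc_cur]

theorem eId_repMap (b : B) : eId V b ≫ repMap (V := V) b b = eId V (VFun.rep (V := V) b) := by
  apply VFun.vHom_ext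
  intro x
  rw [Category.assoc, VFun.eId_ev]
  apply unc_injective
  rw [unc_precomp, unc_repMap_ev, unc_eId, braiding_naturality_right_assoc, ← cancel_epi (ρ_ _).inv]
  simp

theorem eComp_repMap (b b' b'' : B) :
    ((β_ (b' ⟶[V] b) (b'' ⟶[V] b')).hom ≫ eComp V b'' b' b) ≫ repMap (V := V) b b'' =
      gcomp V (repMap (V := V) b b') (repMap (V := V) b' b'') := by
  apply VFun.vHom_ext
  intro x
  rw [VFun.gcomp_ev, Category.assoc]
  apply unc_injective
  rw [unc_gcomp, unc_precomp, unc_repMap_ev, unc_repMap_ev, unc_repMap_ev,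
    MonoidalCategory.comp_whiskerRight, MonoidalCategory.whiskerLeft_comp, Category.assoc,
    Category.assoc, braiding_naturality_right_assoc, braiding_naturality_left_assoc, ← e_assoc]
  simp only [braiding_tensor_left_hom, braiding_tensor_right_hom, Category.assoc]
  rw [← yang_baxter_assoc]

/-- The Yoneda embedding `Bᵒᵖ ⥤ V-Cat[B, V]`, `b ↦ B(b, -)`, as a `V`-functor. -/
def VFun.yoneda (V : Type u) [Category.{w} V] [MonoidalCategory V] [SymmetricCategory V]
    [MonoidalClosed V] [HasLimits V] (B : Type w) [EnrichedCategory V B] :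
    VFun V Bᵒᵖ (VFun V B V) where
  obj b := VFun.rep b.unop
  map b b' := repMap b.unop b'.unop
  map_id b := eId_repMap b.unop
  map_comp b b' b'' := eComp_repMap b.unop b'.unop b''.unop

end ValuedInV

section LeftKanExtension

variable {V : Type u} [Category.{w} V] [MonoidalCategory V]
  [MonoidalClosed V] [HasColimits V]
variable {A : Type w} [EnrichedCategory V A] {B : Type w} [EnrichedCategory V B]

/-- The map `∐_{a, a'} (F a ⊗ A(a, a')) ⊗ B(J a', b) ⟶ ∐ₐ F a ⊗ B(J a, b)` induced by the action
of `F`. -/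
def lanLeft (J : VFun V A B) (F : VFun V A V) (b : B) :
    (∐ fun p : A × A => (F.obj p.1 ⊗ (p.1 ⟶[V] p.2)) ⊗ (J.obj p.2 ⟶[V] b)) ⟶
      ∐ fun a : A => F.obj a ⊗ (J.obj a ⟶[V] b) :=
  Sigma.desc fun p => F.act p.1 p.2 ▷ _ ≫ Sigma.ι (fun a : A => F.obj a ⊗ (J.obj a ⟶[V] b)) p.2

/-- The map `∐_{a, a'} (F a ⊗ A(a, a')) ⊗ B(J a', b) ⟶ ∐ₐ F a ⊗ B(J a, b)` induced by the action
of `J` and composition in `B`. -/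
def lanRight (J : VFun V A B) (F : VFun V A V) (b : B) :
    (∐ fun p : A × A => (F.obj p.1 ⊗ (p.1 ⟶[V] p.2)) ⊗ (J.obj p.2 ⟶[V] b)) ⟶
      ∐ fun a : A => F.obj a ⊗ (J.obj a ⟶[V] b) :=
  Sigma.desc fun p => (α_ _ _ _).hom ≫ F.obj p.1 ◁ gcomp V (J.map p.1 p.2) (𝟙 (J.obj p.2 ⟶[V] b)) ≫
    Sigma.ι (fun a : A => F.obj a ⊗ (J.obj a ⟶[V] b)) p.1

/-- The value at `b` of the left Kan extension of `F : A ⥤ V` along `J : A ⥤ B`: the coend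
`∫ᵃ F a ⊗ B(J a, b)`, as the coequalizer of the two maps above. -/
def lanObj (J : VFun V A B) (F : VFun V A V) (b : B) : V :=
  coequalizer (lanLeft J F b) (lanRight J F b)

namespace lanObj

variable (J : VFun V A B) (F : VFun V A V) (b : B)

/-- The coprojections of the coend. -/
def ι (a : A) : F.obj a ⊗ (J.obj a ⟶[V] b) ⟶ lanObj J F b :=
  Sigma.ι (fun a : A => F.obj a ⊗ (J.obj a ⟶[V] b)) a ≫ coequalizer.π _ _

theorem ι_condition (a a' : A) :
    F.act a a' ▷ (J.obj a' ⟶[V] b) ≫ ι J F b a' =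
      (α_ _ _ _).hom ≫ F.obj a ◁ gcomp V (J.map a a') (𝟙 (J.obj a' ⟶[V] b)) ≫ ι J F b a := by
  have h := Sigma.ι (fun p : A × A => (F.obj p.1 ⊗ (p.1 ⟶[V] p.2)) ⊗ (J.obj p.2 ⟶[V] b)) (a, a') ≫=
    coequalizer.condition (lanLeft J F b) (lanRight J F b)
  rw [lanLeft, lanRight, Sigma.ι_desc_assoc, Sigma.ι_desc_assoc] at h
  simp only [Category.assoc] at h
  exact h

variable {J F b}

/-- The universal property of the coend. -/
def desc₀ {Z : V} (f : ∀ a, F.obj a ⊗ (J.obj a ⟶[V] b) ⟶ Z)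
    (hf : ∀ a a', F.act a a' ▷ (J.obj a' ⟶[V] b) ≫ f a' =
      (α_ _ _ _).hom ≫ F.obj a ◁ gcomp V (J.map a a') (𝟙 (J.obj a' ⟶[V] b)) ≫ f a) :
    lanObj J F b ⟶ Z :=
  coequalizer.desc (Sigma.desc f) (by
    apply Sigma.hom_ext
    rintro ⟨a, a'⟩
    rw [lanLeft, lanRight, Sigma.ι_desc_assoc, Sigma.ι_desc_assoc]
    simp only [Category.assoc, Sigma.ι_desc]
    exact hf a a')

theorem ι_desc₀ {Z : V} (f : ∀ a, F.obj a ⊗ (J.obj a ⟶[V] b) ⟶ Z)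
    (hf : ∀ a a', F.act a a' ▷ (J.obj a' ⟶[V] b) ≫ f a' =
      (α_ _ _ _).hom ≫ F.obj a ◁ gcomp V (J.map a a') (𝟙 (J.obj a' ⟶[V] b)) ≫ f a) (a : A) :
    ι J F b a ≫ desc₀ f hf = f a :=
  (Category.assoc _ _ _).trans ((whisker_eq _ (coequalizer.π_desc (Sigma.desc f) _)).trans
    (Sigma.ι_desc f a))

theorem hom_ext₀ {Z : V} {f g : lanObj J F b ⟶ Z} (h : ∀ a, ι J F b a ≫ f = ι J F b a ≫ g) :
    f = g := by
  apply coequalizer.hom_ext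
  apply Sigma.hom_ext
  intro a
  exact (Category.assoc _ _ _).symm.trans ((h a).trans (Category.assoc _ _ _))

variable [SymmetricCategory V]

/-- The universal property of the coend, in the presence of a parameter `X`. -/
def desc {X Z : V} (f : ∀ a, (F.obj a ⊗ (J.obj a ⟶[V] b)) ⊗ X ⟶ Z)
    (hf : ∀ a a', F.act a a' ▷ (J.obj a' ⟶[V] b) ▷ X ≫ f a' =
      (α_ _ _ _).hom ▷ X ≫
        (F.obj a ◁ gcomp V (J.map a a') (𝟙 (J.obj a' ⟶[V] b))) ▷ X ≫ f a) :
    lanObj J F b ⊗ X ⟶ Z :=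
  (β_ _ _).hom ≫ MonoidalClosed.uncurry
    (desc₀ (fun a => MonoidalClosed.curry ((β_ _ _).hom ≫ f a)) (fun a a' => by
      rw [← MonoidalClosed.curry_natural_left, ← MonoidalClosed.curry_natural_left,
        ← MonoidalClosed.curry_natural_left, braiding_naturality_right_assoc,
        braiding_naturality_right_assoc, braiding_naturality_right_assoc, hf a a']))

theorem ι_desc {X Z : V} (f : ∀ a, (F.obj a ⊗ (J.obj a ⟶[V] b)) ⊗ X ⟶ Z)
    (hf : ∀ a a', F.act a a' ▷ (J.obj a' ⟶[V] b) ▷ X ≫ f a' =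
      (α_ _ _ _).hom ▷ X ≫
        (F.obj a ◁ gcomp V (J.map a a') (𝟙 (J.obj a' ⟶[V] b))) ▷ X ≫ f a) (a : A) :
    ι J F b a ▷ X ≫ desc f hf = f a := by
  rw [desc, braiding_naturality_left_assoc, ← MonoidalClosed.uncurry_natural_left, ι_desc₀,
    MonoidalClosed.uncurry_curry, SymmetricCategory.symmetry_assoc]

theorem hom_ext {X Z : V} {f g : lanObj J F b ⊗ X ⟶ Z}
    (h : ∀ a, ι J F b a ▷ X ≫ f = ι J F b a ▷ X ≫ g) : f = g := by
  rw [← cancel_epi (β_ X (lanObj J F b)).hom]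
  apply MonoidalClosed.curry_injective
  apply hom_ext₀
  intro a
  rw [← MonoidalClosed.curry_natural_left, ← MonoidalClosed.curry_natural_left,
    braiding_naturality_right_assoc, braiding_naturality_right_assoc, h a]

end lanObj

namespace VFun

variable [SymmetricCategory V] (J : VFun V A B)

/-- The action `(∫ᵃ F a ⊗ B(J a, b)) ⊗ B(b, b') ⟶ ∫ᵃ F a ⊗ B(J a, b')` given by composition. -/
def lanAct (F : VFun V A V) (b b' : B) : lanObj J F b ⊗ (b ⟶[V] b') ⟶ lanObj J F b' :=
  lanObj.desc (fun a => (α_ _ _ _).hom ≫ F.obj a ◁ eComp V (J.obj a) b b' ≫ lanObj.ι J F b' a)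
    (fun a a' => by
      have h : (a ⟶[V] a') ◁ eComp V (J.obj a') b b' ≫ gcomp V (J.map a a') (𝟙 _) =
          (α_ _ _ _).inv ≫ gcomp V (J.map a a') (𝟙 _) ▷ _ ≫ eComp V (J.obj a) b b' := by
        rw [← eComp_eq_gcomp, ← eComp_eq_gcomp, ← gcomp_precomp_right, ← gcomp_precomp_left,
          Category.comp_id, Category.comp_id, gcomp_assoc']
      rw [associator_naturality_left_assoc, ← whisker_exchange_assoc, lanObj.ι_condition]
      have h' := congrArg (fun t => F.obj a ◁ t) h
      simp only [MonoidalCategory.whiskerLeft_comp] at h'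
      rw [associator_naturality_right_assoc, reassoc_of% h']
      simp)

theorem ι_lanAct (F : VFun V A V) (b b' : B) (a : A) :
    lanObj.ι J F b a ▷ (b ⟶[V] b') ≫ lanAct J F b b' =
      (α_ _ _ _).hom ≫ F.obj a ◁ eComp V (J.obj a) b b' ≫ lanObj.ι J F b' a :=
  lanObj.ι_desc _ _ a

/-- The left Kan extension `Lan_J F : B ⥤ V` of `F : A ⥤ V` along `J : A ⥤ B`. -/
abbrev lanFun (F : VFun V A V) : VFun V B V where
  obj b := lanObj J F b
  map b b' := cur (lanAct J F b b')
  map_id b := by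
    apply unc_injective
    rw [unc_precomp, unc_cur, unc_eId]
    apply lanObj.hom_ext
    intro a
    rw [← whisker_exchange_assoc, ι_lanAct]
    have h : F.obj a ◁ (J.obj a ⟶[V] b) ◁ eId V b ≫ F.obj a ◁ eComp V (J.obj a) b b =
        F.obj a ◁ (ρ_ _).hom := by
      rw [← MonoidalCategory.whiskerLeft_comp, ← cancel_epi (F.obj a ◁ (ρ_ _).inv),
        ← MonoidalCategory.whiskerLeft_comp, ← MonoidalCategory.whiskerLeft_comp, e_comp_id,
        Iso.inv_hom_id]
    rw [associator_naturality_right_assoc, reassoc_of% h]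
    simp
  map_comp b b' b'' := by
    apply unc_injective
    change _ = unc (gcomp V _ _)
    rw [unc_gcomp, unc_precomp, unc_cur, unc_cur, unc_cur]
    apply lanObj.hom_ext
    intro a
    have h := congrArg (fun t => F.obj a ◁ t) (e_assoc V (J.obj a) b b' b'')
    simp only [MonoidalCategory.whiskerLeft_comp] at h
    rw [← whisker_exchange_assoc, ι_lanAct, associator_inv_naturality_left_assoc,
      ← MonoidalCategory.comp_whiskerRight_assoc, ι_lanAct, MonoidalCategory.comp_whiskerRight,
      MonoidalCategory.comp_whiskerRight, Category.assoc, Category.assoc, ι_lanAct,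
      associator_naturality_right_assoc, ← reassoc_of% h]
    simp

variable [HasLimits V]

/-- The action `(∫ᵃ F a ⊗ B(J a, b)) ⊗ [A, V](F, G) ⟶ ∫ᵃ G a ⊗ B(J a, b)` given by evaluation. -/
def lanNat (F G : VFun V A V) (b : B) : lanObj J F b ⊗ (F ⟶[V] G) ⟶ lanObj J G b :=
  lanObj.desc
    (fun a => (α_ _ _ _).hom ≫ F.obj a ◁ (β_ (J.obj a ⟶[V] b) (F ⟶[V] G)).hom ≫ (α_ _ _ _).inv ≫
      unc (ev F G a) ▷ (J.obj a ⟶[V] b) ≫ lanObj.ι J G b a)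
    (fun a a' => by
      have h := act_unc (isVWedge_ev F G) a a'
      have h' := congrArg (fun t => t ▷ (J.obj a' ⟶[V] b)) h
      simp only [MonoidalCategory.comp_whiskerRight] at h'
      rw [associator_naturality_left_assoc, ← whisker_exchange_assoc,
        associator_inv_naturality_left_assoc, reassoc_of% h', lanObj.ι_condition,
        associator_naturality_left_assoc, ← whisker_exchange_assoc]
      have hb := congrArg (fun t => F.obj a ◁ t) (braiding_naturality_left
        (gcomp V (J.map a a') (𝟙 (J.obj a' ⟶[V] b))) (F ⟶[V] G))
      simp only [MonoidalCategory.whiskerLeft_comp, braiding_tensor_left_hom] at hb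
      simp [reassoc_of% hb])

theorem ι_lanNat (F G : VFun V A V) (b : B) (a : A) :
    lanObj.ι J F b a ▷ (F ⟶[V] G) ≫ lanNat J F G b =
      (α_ _ _ _).hom ≫ F.obj a ◁ (β_ (J.obj a ⟶[V] b) (F ⟶[V] G)).hom ≫ (α_ _ _ _).inv ≫
        unc (ev F G a) ▷ (J.obj a ⟶[V] b) ≫ lanObj.ι J G b a :=
  lanObj.ι_desc _ _ a

theorem isVWedge_lanNat (F G : VFun V A V) :
    IsVWedge (lanFun J F) (lanFun J G) fun b => cur (lanNat J F G b) := by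
  intro b b'
  apply unc_injective
  rw [unc_precomp, unc_gcomp, unc_gcomp, unc_cur, unc_cur, unc_cur, unc_cur]
  apply lanObj.hom_ext
  intro a
  have h := congrArg (fun t => t ▷ (b ⟶[V] b')) (ι_lanNat J F G b a)
  have hb := congrArg (fun t => F.obj a ◁ t) (braiding_naturality_left
    (eComp V (J.obj a) b b') (F ⟶[V] G))
  simp only [MonoidalCategory.whiskerLeft_comp, MonoidalCategory.comp_whiskerRight,
    braiding_tensor_left_hom] at h hb
  rw [associator_inv_naturality_left_assoc, ← MonoidalCategory.comp_whiskerRight_assoc, ι_lanAct,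
    MonoidalCategory.comp_whiskerRight, MonoidalCategory.comp_whiskerRight, Category.assoc,
    Category.assoc, ι_lanNat, ← whisker_exchange_assoc, associator_inv_naturality_left_assoc,
    reassoc_of% h, ι_lanAct, associator_naturality_left_assoc, ← whisker_exchange_assoc]
  simp [reassoc_of% hb]

/-- The left Kan extension `V`-functor `Lan_J : V-Cat[A, V] ⥤ V-Cat[B, V]`. -/
def lan : VFun V (VFun V A V) (VFun V B V) where
  obj F := lanFun J F
  map F G := lift (F := lanFun J F) (G := lanFun J G) (fun b => cur (lanNat J F G b))
    (isVWedge_lanNat J F G)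
  map_id F := by
    apply vHom_ext
    intro b
    rw [Category.assoc, lift_ev, eId_ev]
    apply unc_injective
    rw [unc_precomp, unc_cur, unc_eId]
    apply lanObj.hom_ext
    intro a
    have h : F.obj a ◁ eId V F ≫ unc (ev F F a) = (ρ_ _).hom := by
      rw [← unc_precomp, eId_ev, unc_eId]
    have h' := congrArg (fun t => t ▷ (J.obj a ⟶[V] b)) h
    have hb := congrArg (fun t => F.obj a ◁ t) (braiding_naturality_right
      (J.obj a ⟶[V] b) (eId V F))
    simp only [MonoidalCategory.whiskerLeft_comp, MonoidalCategory.comp_whiskerRight,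
      braiding_tensorUnit_right] at h' hb
    rw [← whisker_exchange_assoc, ι_lanNat, associator_naturality_right_assoc, reassoc_of% hb,
      associator_inv_naturality_middle_assoc, reassoc_of% h']
    simp
  map_comp F G H := by
    apply vHom_ext
    intro b
    change _ = gcomp V _ _ ≫ _
    rw [gcomp_ev, lift_ev, lift_ev, Category.assoc, lift_ev]
    apply unc_injective
    rw [unc_gcomp, unc_precomp, unc_cur, unc_cur, unc_cur]
    apply lanObj.hom_ext
    intro a
    rw [← whisker_exchange_assoc, ι_lanNat, associator_inv_naturality_left_assoc,
      ← MonoidalCategory.comp_whiskerRight_assoc, ι_lanNat]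
    simp only [MonoidalCategory.comp_whiskerRight, Category.assoc]
    have h : F.obj a ◁ eComp V F G H ≫ unc (ev F H a) =
        (α_ _ _ _).inv ≫ unc (ev F G a) ▷ _ ≫ unc (ev G H a) := by
      rw [← unc_precomp, eComp_ev, unc_gcomp]
    have h' := congrArg (fun t => t ▷ (J.obj a ⟶[V] b)) h
    have hb := congrArg (fun t => F.obj a ◁ t) (braiding_naturality_right
      (J.obj a ⟶[V] b) (eComp V F G H))
    simp only [MonoidalCategory.whiskerLeft_comp, MonoidalCategory.comp_whiskerRight,
      braiding_tensor_right_hom] at h' hb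
    rw [ι_lanNat, associator_naturality_right_assoc, reassoc_of% hb,
      associator_inv_naturality_middle_assoc, reassoc_of% h', associator_naturality_left_assoc,
      ← whisker_exchange_assoc, associator_inv_naturality_left_assoc]
    simp

end VFun

end LeftKanExtension

end EnrichedLaxEpi

end

/-!
Everything turns on the coends `M(b, x) = ∫ᵃ B(b, J a) ⊗ B(J a, x)`, the values of
`Lan_J B(b, J-)`, on which `B` acts from both sides; `[u, v]` stands for the class of a pair
`u : b ⟶ J a`, `v : J a ⟶ x`. The density condition says precisely that `M` is isomorphic to the
bimodule `B(b, x)` (`VFun.nonempty_lanRepIso_iff`).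

*Ordinary full faithfulness at `V` implies density* (`VFun.nonempty_lanRepIso`). By fullness, the
`V`-natural family `u ↦ [u, 1]`, `B(b, J a) ⟶ M(b, J a)`, extends to a `V`-natural transformation
`σ : B(b, -) ⟶ M(b, -)`. Since `[u, v]` is the image of `[u, 1]` under `v`, composition
`M(b, x) ⟶ B(b, x)` followed by `σ` is the identity. So is `σ` followed by composition, by
faithfulness, as it restricts to the identity on the objects `J a`.

*Density implies `V`-full faithfulness at every `C`*
(`VFun.LanRepIso.vPrecomp_fullyFaithful`). Let `φ : M ≅ B` be any isomorphism of bimodules. It need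
not be composition, but `φ[u, v] = v ∘ k(u)` for the twist `k(u) = φ[u, 1]`, and `k` is invertible
(`VFun.LanRepIso.isIso_twist`). Given a `V`-natural family `f : X ⟶ C(F J a, G J a)`, the assignment
`[u, v] ↦ G v ∘ f ∘ F (k u)` defines a map `M(b, x) ⊗ X ⟶ C(F b, G x)` compatible with both actions;
transported along `φ` to `B(b, x) ⊗ X` and evaluated at identities, it gives a `V`-natural family on
`B`. That this extends `f` follows by cancelling `k`. Extensions are unique because
`g_x ∘ F(φ[u, v])` depends only on the restriction of `g` along `J`.

The remaining implications are changes of size and passage to elements `I ⟶ [A, C](F, G)`, which are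
the `V`-natural transformations (`VFun.elementEquiv`): two `V`-functors `B ⥤ V` factor through
a small `V`-category with hom-objects taken from `V`, so that testing against small `V`-categories
covers `V` itself.
-/

noncomputable section

namespace EnrichedLaxEpi

/-! ### Natural families and elements of functor `V`-categories -/

section Elements

variable {V : Type u} [Category.{w} V] [MonoidalCategory V] [SymmetricCategory V]

section

variable {A : Type u₁} [EnrichedCategory V A] {C : Type u₂} [EnrichedCategory V C]

theorem IsVWedge.comp_left {F G : VFun V A C} {X Y : V} {f : ∀ a, X ⟶ (F.obj a ⟶[V] G.obj a)}
    (hf : IsVWedge F G f) (g : Y ⟶ X) : IsVWedge F G fun a => g ≫ f a := by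
  intro a b
  rw [gcomp_precomp_left, gcomp_precomp_right, hf, braiding_naturality_right_assoc]

/-- Wedges with vertex `I` are the same as `V`-natural transformations. -/
theorem isVWedge_unit_iff {F G : VFun V A C} (f : ∀ a, 𝟙_ V ⟶ (F.obj a ⟶[V] G.obj a)) :
    IsVWedge F G f ↔ ∀ a b, (λ_ (a ⟶[V] b)).inv ≫ gcomp V (f a) (G.map a b) =
      (ρ_ (a ⟶[V] b)).inv ≫ gcomp V (F.map a b) (f b) := by
  refine forall₂_congr fun a b => ?_
  rw [braiding_tensorUnit_right, Category.assoc, ← Iso.inv_comp_eq]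
  exact eq_comm

theorem VNatTrans.isVWedge {F G : VFun V A C} (t : F ⟶ G) : IsVWedge F G (VNatTrans.app t) :=
  (isVWedge_unit_iff _).2 (VNatTrans.naturality t)

end

variable [MonoidalClosed V] [HasLimits V]
variable {A : Type w} [EnrichedCategory V A] {C : Type u₂} [EnrichedCategory V C]

/-- The elements `I ⟶ [A, C](F, G)` of a hom-object of a functor `V`-category are the
`V`-natural transformations `F ⟶ G`. -/
def VFun.elementEquiv (F G : VFun V A C) : (𝟙_ V ⟶ (F ⟶[V] G)) ≃ (F ⟶ G) where
  toFun s :=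
    { app := fun a => s ≫ VFun.ev F G a
      naturality := (isVWedge_unit_iff _).1 ((VFun.isVWedge_ev F G).comp_left s) }
  invFun t := VFun.lift (VNatTrans.app t) (VNatTrans.isVWedge t)
  left_inv _ := VFun.vHom_ext fun a => VFun.lift_ev _ _ a
  right_inv _ := VFun.hom_ext fun a => VFun.lift_ev _ _ a

theorem VFun.elementEquiv_app {F G : VFun V A C} (s : 𝟙_ V ⟶ (F ⟶[V] G)) (a : A) :
    VNatTrans.app (VFun.elementEquiv F G s) a = s ≫ VFun.ev F G a := rfl

/-- The action of `V-Cat[J, C]` on hom-objects, restriction `[B, C](F, G) ⟶ [A, C](F J, G J)`. -/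
def VFun.restrict {B : Type w} [EnrichedCategory V B] (J : VFun V A B) (F G : VFun V B C) :
    (F ⟶[V] G) ⟶ (J.comp F ⟶[V] J.comp G) :=
  (J.vPrecomp C).map F G

theorem VFun.restrict_ev {B : Type w} [EnrichedCategory V B] (J : VFun V A B) (F G : VFun V B C)
    (a : A) : J.restrict F G ≫ VFun.ev (J.comp F) (J.comp G) a = VFun.ev F G (J.obj a) :=
  VFun.lift_ev (F := J.comp F) (G := J.comp G) _ ((VFun.isVWedge_ev F G).precomp J) a

/-- `V`-full faithfulness of `V-Cat[J, C]` implies that the ordinary functor `V-Cat(J, C)`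
is fully faithful. -/
theorem VFun.precomp_full_faithful {B : Type w} [EnrichedCategory V B] (J : VFun V A B)
    (h : (J.vPrecomp C).IsVFullyFaithful) : (J.precomp C).Full ∧ (J.precomp C).Faithful := by
  have key : ∀ (F G : VFun V B C) (s : 𝟙_ V ⟶ (F ⟶[V] G)),
      (J.precomp C).map (VFun.elementEquiv F G s) =
        VFun.elementEquiv (J.comp F) (J.comp G) (s ≫ J.restrict F G) := by
    intro F G s
    apply VFun.hom_ext
    intro a
    rw [VFun.elementEquiv_app, Category.assoc, VFun.restrict_ev]
    rfl
  refine ⟨⟨fun {F G} t => ?_⟩, ⟨fun {F G} s t hst => ?_⟩⟩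
  · have : IsIso (J.restrict F G) := h F G
    refine ⟨VFun.elementEquiv F G
      ((VFun.elementEquiv (J.comp F) (J.comp G)).symm t ≫ inv (J.restrict F G)), ?_⟩
    rw [key, Category.assoc, IsIso.inv_hom_id, Category.comp_id]
    exact Equiv.apply_symm_apply _ t
  · have : IsIso (J.restrict F G) := h F G
    obtain ⟨s, rfl⟩ := (VFun.elementEquiv F G).surjective s
    obtain ⟨t, rfl⟩ := (VFun.elementEquiv F G).surjective t
    rw [key, key] at hst
    rw [(cancel_mono _).1 ((VFun.elementEquiv (J.comp F) (J.comp G)).injective hst)]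

/-- Evaluation at `a`, as a `V`-functor `V-Cat[A, C] ⥤ C`. -/
abbrev VFun.evalFun (C : Type u₂) [EnrichedCategory V C] (a : A) : VFun V (VFun V A C) C where
  obj F := F.obj a
  map F G := VFun.ev F G a
  map_id F := VFun.eId_ev F a
  map_comp F G H := VFun.eComp_ev F G H a

end Elements

/-! ### Induced `V`-categories and change of size -/

section Induced

variable {V : Type u} [Category.{w} V] [MonoidalCategory V]
  {C : Type u₂} [EnrichedCategory V C] {S : Type u₁}

/-- The `V`-category with object type `S` whose hom-objects are those of `C` between the images
under `H : S → C`. -/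
def InducedVCat {C : Type u₂} {S : Type u₁} (_ : S → C) : Type u₁ := S

instance (H : S → C) : EnrichedCategory V (InducedVCat H) where
  Hom x y := EnrichedCategory.Hom (V := V) (H x) (H y)
  id x := eId V (H x)
  comp x y z := eComp V (H x) (H y) (H z)
  id_comp x y := e_id_comp V (H x) (H y)
  comp_id x y := e_comp_id V (H x) (H y)
  assoc x y z t := e_assoc V (H x) (H y) (H z) (H t)

variable {A B : Type w} [EnrichedCategory V A] [EnrichedCategory V B]

/-- Full faithfulness of `V-Cat(J, C)` for small `C` implies it for all `C`: two given `V`-functors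
`B ⥤ C` factor through the small `V`-category on `B ⊕ B` induced from `C` by both. -/
theorem VFun.precomp_full_faithful_of_small (J : VFun V A B)
    (h : ∀ (C : Type w) [EnrichedCategory V C], (J.precomp C).Full ∧ (J.precomp C).Faithful) :
    (J.precomp C).Full ∧ (J.precomp C).Faithful := by
  have key : ∀ F G : VFun V B C, Function.Bijective ((J.precomp C).map : (F ⟶ G) → _) := by
    intro F G
    let H : B ⊕ B → C := Sum.elim F.obj G.obj
    let F' : VFun V B (InducedVCat H) :=
      { obj := Sum.inl, map := F.map, map_id := F.map_id, map_comp := F.map_comp }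
    let G' : VFun V B (InducedVCat H) :=
      { obj := Sum.inr, map := G.map, map_id := G.map_id, map_comp := G.map_comp }
    obtain ⟨full, faithful⟩ := h (InducedVCat H)
    constructor
    · intro s t hst
      have := faithful.map_injective (X := F') (Y := G')
        (a₁ := { app := VNatTrans.app (F := F) (G := G) s
                 naturality := VNatTrans.naturality (F := F) (G := G) s })
        (a₂ := { app := VNatTrans.app (F := F) (G := G) t
                 naturality := VNatTrans.naturality (F := F) (G := G) t })
        (VFun.hom_ext fun a => congrFun (congrArg VNatTrans.app hst) a)
      exact VFun.hom_ext fun b => congrFun (congrArg VNatTrans.app this) b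
    · intro t
      obtain ⟨s, hs⟩ := full.map_surjective (X := F') (Y := G')
        { app := VNatTrans.app (F := J.comp F) (G := J.comp G) t
          naturality := VNatTrans.naturality (F := J.comp F) (G := J.comp G) t }
      exact ⟨{ app := VNatTrans.app (F := F') (G := G') s
               naturality := VNatTrans.naturality (F := F') (G := G') s },
        VFun.hom_ext fun a => congrFun (congrArg VNatTrans.app hs) a⟩
  exact ⟨⟨fun t => (key _ _).2 t⟩, ⟨fun h => (key _ _).1 h⟩⟩

/-- Raising the universe level of the objects of `C` does not affect `V`-full faithfulness of
`V-Cat[J, C]`, because the hom-objects are the same. -/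
theorem VFun.isVFullyFaithful_vPrecomp_of_uLift [SymmetricCategory V] [MonoidalClosed V]
    [HasLimits V] (J : VFun V A B)
    (h : (J.vPrecomp (InducedVCat (ULift.down : ULift.{u₃} C → C))).IsVFullyFaithful) :
    (J.vPrecomp C).IsVFullyFaithful := by
  intro F G
  exact h
    { obj := fun b => (ULift.up (F.obj b) : ULift.{u₃} C)
      map := F.map, map_id := F.map_id, map_comp := F.map_comp }
    { obj := fun b => (ULift.up (G.obj b) : ULift.{u₃} C)
      map := G.map, map_id := G.map_id, map_comp := G.map_comp }

end Induced

/-! ### Components of transformations between `V`-valued functors -/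

section Components

variable {V : Type u} [Category.{w} V] [MonoidalCategory V]
  [MonoidalClosed V]
variable {A : Type u₁} [EnrichedCategory V A]

/-- The component `F a ⟶ G a` of a `V`-natural transformation between `V`-functors `A ⥤ V`. -/
def VFun.component {F G : VFun V A V} (t : F ⟶ G) (a : A) : F.obj a ⟶ G.obj a :=
  (ρ_ _).inv ≫ unc (VNatTrans.app t a)

theorem VFun.cur_component {F G : VFun V A V} (t : F ⟶ G) (a : A) :
    cur ((ρ_ _).hom ≫ VFun.component t a) = VNatTrans.app t a := by
  apply unc_injective
  rw [unc_cur, VFun.component, Iso.hom_inv_id_assoc]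

theorem VFun.component_ext {F G : VFun V A V} {s t : F ⟶ G}
    (h : ∀ a, VFun.component s a = VFun.component t a) : s = t := by
  apply VFun.hom_ext
  intro a
  rw [← VFun.cur_component s, h, VFun.cur_component]

theorem VFun.component_id (F : VFun V A V) (a : A) : VFun.component (𝟙 F) a = 𝟙 _ := by
  rw [VFun.component, VFun.id_app, unc_eId, Iso.inv_hom_id]

theorem VFun.component_comp {F G H : VFun V A V} (s : F ⟶ G) (t : G ⟶ H) (a : A) :
    VFun.component (s ≫ t) a = VFun.component s a ≫ VFun.component t a := by
  rw [VFun.component, VFun.comp_app, unc_precomp, unc_gcomp, VFun.component, VFun.component,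
    Category.assoc, rightUnitor_inv_naturality_assoc]
  monoidal

variable [SymmetricCategory V]

/-- For `V`-functors into `V`, a `V`-natural family with vertex `I` amounts to maps `F a ⟶ G a`
compatible with the actions of `A`. -/
theorem isVWedge_cur_iff {F G : VFun V A V} (θ : ∀ a, F.obj a ⟶ G.obj a) :
    IsVWedge F G (fun a => cur ((ρ_ _).hom ≫ θ a)) ↔
      ∀ a a', F.act a a' ≫ θ a' = θ a ▷ (a ⟶[V] a') ≫ G.act a a' := by
  refine forall₂_congr fun a a' => ?_
  rw [← Function.Injective.eq_iff (f := unc) fun _ _ h => unc_injective h, unc_precomp, unc_gcomp,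
    unc_gcomp, unc_cur, unc_cur, ← cancel_epi ((ρ_ _).inv ≫ (α_ _ _ _).hom)]
  simp [VFun.act, braiding_tensorUnit_right]

theorem VFun.component_naturality {F G : VFun V A V} (t : F ⟶ G) (a a' : A) :
    F.act a a' ≫ VFun.component t a' = VFun.component t a ▷ (a ⟶[V] a') ≫ G.act a a' := by
  refine (isVWedge_cur_iff (VFun.component t)).1 ?_ a a'
  simp only [VFun.cur_component]
  exact VNatTrans.isVWedge t

/-- The `V`-natural transformation between `V`-functors `A ⥤ V` given by a family compatible
with the actions. -/
def VFun.homMk {F G : VFun V A V} (θ : ∀ a, F.obj a ⟶ G.obj a)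
    (hθ : ∀ a a', F.act a a' ≫ θ a' = θ a ▷ (a ⟶[V] a') ≫ G.act a a') : F ⟶ G where
  app a := cur ((ρ_ _).hom ≫ θ a)
  naturality := (isVWedge_unit_iff _).1 ((isVWedge_cur_iff θ).2 hθ)

theorem VFun.component_homMk {F G : VFun V A V} (θ : ∀ a, F.obj a ⟶ G.obj a)
    (hθ : ∀ a a', F.act a a' ≫ θ a' = θ a ▷ (a ⟶[V] a') ≫ G.act a a') (a : A) :
    VFun.component (VFun.homMk θ hθ) a = θ a := by
  change _ ≫ unc (cur _) = _
  rw [unc_cur, Iso.inv_hom_id_assoc]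

end Components

section Parametrized

variable {V : Type u} [Category.{w} V] [MonoidalCategory V] [SymmetricCategory V]
  [MonoidalClosed V] [HasLimits V]
variable {D : Type u₁} [EnrichedCategory V D] {B : Type w} [EnrichedCategory V B]

/-- The component `P(d, x) ⟶ Q(d, x)` of a `V`-natural transformation between `V`-functors
`D ⥤ V-Cat[B, V]`. -/
def VFun.component₂ {P Q : VFun V D (VFun V B V)} (t : P ⟶ Q) (d : D) (x : B) :
    (P.obj d).obj x ⟶ (Q.obj d).obj x :=
  VFun.component (VFun.whiskerRight t (VFun.evalFun V x)) d

theorem VFun.component₂_left {P Q : VFun V D (VFun V B V)} (t : P ⟶ Q) (d d' : D) (x : B) :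
    (P.comp (VFun.evalFun V x)).act d d' ≫ VFun.component₂ t d' x =
      VFun.component₂ t d x ▷ (d ⟶[V] d') ≫ (Q.comp (VFun.evalFun V x)).act d d' :=
  VFun.component_naturality (VFun.whiskerRight t (VFun.evalFun V x)) d d'

theorem VFun.component₂_right {P Q : VFun V D (VFun V B V)} (t : P ⟶ Q) (d : D) (x y : B) :
    (P.obj d).act x y ≫ VFun.component₂ t d y =
      VFun.component₂ t d x ▷ (x ⟶[V] y) ≫ (Q.obj d).act x y :=
  VFun.component_naturality (VFun.elementEquiv _ _ (VNatTrans.app t d)) x y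

theorem VFun.component₂_id (P : VFun V D (VFun V B V)) (d : D) (x : B) :
    VFun.component₂ (𝟙 P) d x = 𝟙 _ := by
  change _ ≫ unc (eId V (P.obj d) ≫ VFun.ev _ _ x) = _
  rw [VFun.eId_ev, unc_eId, Iso.inv_hom_id]

theorem VFun.component₂_comp {P Q R : VFun V D (VFun V B V)} (s : P ⟶ Q) (t : Q ⟶ R) (d : D)
    (x : B) :
    VFun.component₂ (s ≫ t) d x = VFun.component₂ s d x ≫ VFun.component₂ t d x := by
  rw [VFun.component₂, VFun.component₂, VFun.component₂, ← VFun.component_comp]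
  congr 1
  apply VFun.hom_ext
  intro d
  change ((λ_ _).inv ≫ gcomp V _ _) ≫ VFun.ev _ _ x = (λ_ _).inv ≫ gcomp V (_ ≫ _) (_ ≫ _)
  rw [Category.assoc, VFun.gcomp_ev]

/-- Isomorphisms `P(d, x) ≅ Q(d, x)` that are `V`-natural in `d` and in `x` make up an isomorphism
of `V`-functors `D ⥤ V-Cat[B, V]`. -/
theorem VFun.nonempty_iso_of_components {P Q : VFun V D (VFun V B V)}
    (θ : ∀ d x, (P.obj d).obj x ≅ (Q.obj d).obj x)
    (left : ∀ d d' x, (P.comp (VFun.evalFun V x)).act d d' ≫ (θ d' x).hom =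
      (θ d x).hom ▷ (d ⟶[V] d') ≫ (Q.comp (VFun.evalFun V x)).act d d')
    (right : ∀ d x y, (P.obj d).act x y ≫ (θ d y).hom =
      (θ d x).hom ▷ (x ⟶[V] y) ≫ (Q.obj d).act x y) : Nonempty (P ≅ Q) := by
  have build : ∀ {P Q : VFun V D (VFun V B V)} (θ : ∀ d x, (P.obj d).obj x ⟶ (Q.obj d).obj x),
      (∀ d d' x, (P.comp (VFun.evalFun V x)).act d d' ≫ θ d' x =
        θ d x ▷ (d ⟶[V] d') ≫ (Q.comp (VFun.evalFun V x)).act d d') →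
      (∀ d x y, (P.obj d).act x y ≫ θ d y = θ d x ▷ (x ⟶[V] y) ≫ (Q.obj d).act x y) →
      ∃ t : P ⟶ Q, ∀ d x, VNatTrans.app t d ≫ VFun.ev _ _ x = cur ((ρ_ _).hom ≫ θ d x) := by
    intro P Q θ left right
    let s (d : D) : 𝟙_ V ⟶ (P.obj d ⟶[V] Q.obj d) :=
      VFun.lift (fun x => cur ((ρ_ _).hom ≫ θ d x)) ((isVWedge_cur_iff _).2 (right d))
    have hs : ∀ d x, s d ≫ VFun.ev _ _ x = cur ((ρ_ _).hom ≫ θ d x) :=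
      fun d x => VFun.lift_ev _ _ x
    refine ⟨{ app := s, naturality := (isVWedge_unit_iff _).1 fun d d' => ?_ }, hs⟩
    apply VFun.vHom_ext
    intro x
    have h := (isVWedge_cur_iff (F := P.comp (VFun.evalFun V x))
      (G := Q.comp (VFun.evalFun V x)) (fun d => θ d x)).2 (fun d d' => left d d' x) d d'
    rw [VFun.gcomp_ev, Category.assoc, VFun.gcomp_ev, hs, hs]
    exact h
  obtain ⟨t, ht⟩ := build (fun d x => (θ d x).hom) left right
  obtain ⟨s, hs⟩ := build (fun d x => (θ d x).inv)
    (fun d d' x => by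
      rw [← cancel_mono (θ d' x).hom, Category.assoc, Category.assoc, left,
        Iso.inv_hom_id, Category.comp_id, ← MonoidalCategory.comp_whiskerRight_assoc,
        Iso.inv_hom_id, MonoidalCategory.id_whiskerRight, Category.id_comp])
    (fun d x y => by
      rw [← cancel_mono (θ d y).hom, Category.assoc, Category.assoc, right,
        Iso.inv_hom_id, Category.comp_id, ← MonoidalCategory.comp_whiskerRight_assoc,
        Iso.inv_hom_id, MonoidalCategory.id_whiskerRight, Category.id_comp])
  refine ⟨⟨t, s, ?_, ?_⟩⟩
  all_goals
    apply VFun.hom_ext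
    intro d
    apply VFun.vHom_ext
    intro x
    rw [VFun.id_app, VFun.eId_ev, VFun.comp_app, Category.assoc, VFun.gcomp_ev, hs, ht]
    apply unc_injective
    rw [unc_precomp, unc_gcomp, unc_cur, unc_cur, unc_eId]
    simp

theorem VFun.yoneda_act (b b' x : B) :
    ((VFun.yoneda V B).comp (VFun.evalFun V x)).act (Opposite.op b) (Opposite.op b') =
      (β_ (b ⟶[V] x) (b' ⟶[V] b)).hom ≫ eComp V b' b x :=
  unc_repMap_ev b b' x

end Parametrized

/-! ### The bimodule `∫ᵃ B(b, J a) ⊗ B(J a, x)` -/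

/-- Coherence: moving `P` past `U ⊗ Y` in one step or past `U` and `Y` separately. -/
theorem braiding_move {V : Type u} [Category.{w} V] [MonoidalCategory V] [SymmetricCategory V]
    {P U U' W Y Z : V} (r : P ⟶ W) (m : U ⊗ W ⟶ U') (c : P ⊗ U ⟶ U')
    (h : U ◁ r ≫ m = (β_ U P).hom ≫ c) (i : U' ⊗ Y ⟶ Z) :
    (β_ P (U ⊗ Y)).hom ≫ (U ⊗ Y) ◁ r ≫ (α_ U Y W).hom ≫ U ◁ (β_ Y W).hom ≫ (α_ U W Y).inv ≫
      m ▷ Y ≫ i = (α_ P U Y).inv ≫ c ▷ Y ≫ i := by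
  have h' := congrArg (· ▷ Y) h
  have hb := congrArg (U ◁ ·) (braiding_naturality_right Y r)
  simp only [MonoidalCategory.comp_whiskerRight, MonoidalCategory.whiskerLeft_comp] at h' hb
  rw [associator_naturality_right_assoc, reassoc_of% hb, associator_inv_naturality_middle_assoc,
    reassoc_of% h', braiding_tensor_right_hom]
  simp [← MonoidalCategory.comp_whiskerRight_assoc, ← MonoidalCategory.whiskerLeft_comp_assoc,
    -MonoidalCategory.comp_whiskerRight, -MonoidalCategory.whiskerLeft_comp]

namespace VFun

section LanRep

variable {V : Type u} [Category.{w} V] [MonoidalCategory V] [MonoidalClosed V]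
variable {A B : Type w} [EnrichedCategory V A] [EnrichedCategory V B] (J : VFun V A B)

theorem comp_act (F : VFun V B V) (a a' : A) :
    (J.comp F).act a a' = F.obj (J.obj a) ◁ J.map a a' ≫ F.act (J.obj a) (J.obj a') :=
  unc_precomp _ _

theorem rep_act (b x y : B) : (VFun.rep (V := V) b).act x y = eComp V b x y := unc_cur _

theorem comp_rep_act (b : B) (a a' : A) :
    (J.comp (VFun.rep (V := V) b)).act a a' = gcomp V (𝟙 (b ⟶[V] J.obj a)) (J.map a a') := by
  change unc (J.map a a' ≫ cur _) = _
  rw [unc_precomp, unc_cur, gcomp]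
  simp

variable [HasColimits V]

/-- The value at `x` of `Lan_J B(b, J-)`, that is, the coend `∫ᵃ B(b, J a) ⊗ B(J a, x)`. -/
abbrev lanRep (b x : B) : V := lanObj J (J.comp (VFun.rep b)) x

/-- The coprojections `B(b, J a) ⊗ B(J a, x) ⟶ ∫ᵃ B(b, J a) ⊗ B(J a, x)`. -/
def lanRepι (b x : B) (a : A) : (b ⟶[V] J.obj a) ⊗ (J.obj a ⟶[V] x) ⟶ lanRep J b x :=
  lanObj.ι J (J.comp (VFun.rep b)) x a

theorem lanRepι_condition (b x : B) (a a' : A) :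
    gcomp V (𝟙 (b ⟶[V] J.obj a)) (J.map a a') ▷ (J.obj a' ⟶[V] x) ≫ lanRepι J b x a' =
      (α_ _ _ _).hom ≫ (b ⟶[V] J.obj a) ◁ gcomp V (J.map a a') (𝟙 (J.obj a' ⟶[V] x)) ≫
        lanRepι J b x a := by
  rw [← comp_rep_act]
  exact lanObj.ι_condition J (J.comp (VFun.rep b)) x a a'

theorem lanRep_hom_ext {b x : B} {Z : V} {f g : lanRep J b x ⟶ Z}
    (h : ∀ a, lanRepι J b x a ≫ f = lanRepι J b x a ≫ g) : f = g :=
  lanObj.hom_ext₀ h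

/-- The map `B(b, J a) ⟶ ∫ᵃ' B(b, J a') ⊗ B(J a', J a)`, `u ↦ [u, 1]`. -/
def lanRepUnit (b : B) (a : A) : (b ⟶[V] J.obj a) ⟶ lanRep J b (J.obj a) :=
  (ρ_ _).inv ≫ (b ⟶[V] J.obj a) ◁ eId V (J.obj a) ≫ lanRepι J b (J.obj a) a

/-- Composition, as a map `∫ᵃ B(b, J a) ⊗ B(J a, x) ⟶ B(b, x)`. -/
def lanRepCounit (b x : B) : lanRep J b x ⟶ (b ⟶[V] x) :=
  lanObj.desc₀ (fun a => eComp V b (J.obj a) x) fun a a' => by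
    rw [comp_rep_act, ← eComp_eq_gcomp, ← eComp_eq_gcomp, ← gcomp_precomp_left,
      ← gcomp_precomp_right, Category.comp_id, Category.comp_id, gcomp_assoc]

theorem lanRepι_counit (b x : B) (a : A) :
    lanRepι J b x a ≫ lanRepCounit J b x = eComp V b (J.obj a) x :=
  lanObj.ι_desc₀ _ _ a

theorem lanRepUnit_counit (b : B) (a : A) :
    lanRepUnit J b a ≫ lanRepCounit J b (J.obj a) = 𝟙 _ := by
  rw [lanRepUnit, Category.assoc, Category.assoc, lanRepι_counit, e_comp_id]

variable [SymmetricCategory V]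

theorem lanRep_hom_ext_right {b x : B} {X Z : V} {f g : lanRep J b x ⊗ X ⟶ Z}
    (h : ∀ a, lanRepι J b x a ▷ X ≫ f = lanRepι J b x a ▷ X ≫ g) : f = g :=
  lanObj.hom_ext h

theorem lanRep_hom_ext_left {b x : B} {X Z : V} {f g : X ⊗ lanRep J b x ⟶ Z}
    (h : ∀ a, X ◁ lanRepι J b x a ≫ f = X ◁ lanRepι J b x a ≫ g) : f = g := by
  rw [← cancel_epi (β_ _ _).hom]
  apply lanObj.hom_ext
  intro a
  rw [braiding_naturality_left_assoc, braiding_naturality_left_assoc]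
  exact congrArg _ (h a)

theorem lanRep_hom_ext_right₂ {b x : B} {X Y Z : V}
    {f g : (lanRep J b x ⊗ Y) ⊗ X ⟶ Z}
    (h : ∀ a, lanRepι J b x a ▷ Y ▷ X ≫ f = lanRepι J b x a ▷ Y ▷ X ≫ g) : f = g := by
  rw [← cancel_epi (α_ _ _ _).inv]
  apply lanRep_hom_ext_right
  intro a
  rw [associator_inv_naturality_left_assoc, associator_inv_naturality_left_assoc, h]

theorem lanRep_hom_ext_middle {b x : B} {X Y Z : V}
    {f g : (Y ⊗ lanRep J b x) ⊗ X ⟶ Z}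
    (h : ∀ a, (Y ◁ lanRepι J b x a) ▷ X ≫ f = (Y ◁ lanRepι J b x a) ▷ X ≫ g) : f = g := by
  rw [← cancel_epi ((β_ (lanRep J b x) Y).hom ▷ X)]
  apply lanRep_hom_ext_right₂
  intro a
  rw [← MonoidalCategory.comp_whiskerRight_assoc, braiding_naturality_left,
    MonoidalCategory.comp_whiskerRight_assoc, h, ← MonoidalCategory.comp_whiskerRight_assoc,
    ← braiding_naturality_left, MonoidalCategory.comp_whiskerRight_assoc]

/-- The right action of `B` on `∫ᵃ B(b, J a) ⊗ B(J a, x)`, composition on the right factor. -/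
def lanRepRight (b x y : B) : lanRep J b x ⊗ (x ⟶[V] y) ⟶ lanRep J b y :=
  lanAct J (J.comp (VFun.rep b)) x y

theorem lanRepι_right (b x y : B) (a : A) :
    lanRepι J b x a ▷ (x ⟶[V] y) ≫ lanRepRight J b x y =
      (α_ _ _ _).hom ≫ (b ⟶[V] J.obj a) ◁ eComp V (J.obj a) x y ≫ lanRepι J b y a :=
  ι_lanAct J (J.comp (VFun.rep b)) x y a

/-- The generator `[u, v]` is `[u, 1]` acted upon by `v`. -/
theorem lanRepUnit_right (b x : B) (a : A) :
    lanRepUnit J b a ▷ (J.obj a ⟶[V] x) ≫ lanRepRight J b (J.obj a) x = lanRepι J b x a := by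
  have h := congrArg ((b ⟶[V] J.obj a) ◁ ·) (e_id_comp V (J.obj a) x)
  simp only [MonoidalCategory.whiskerLeft_comp] at h
  simp only [lanRepUnit, MonoidalCategory.comp_whiskerRight, Category.assoc, lanRepι_right,
    associator_naturality_middle_assoc]
  rw [← cancel_epi ((b ⟶[V] J.obj a) ◁ (𝟙 (J.obj a ⟶[V] x)))]
  conv_rhs => rw [← h]
  simp

theorem lanRepUnit_condition (b : B) (a a' : A) :
    gcomp V (𝟙 (b ⟶[V] J.obj a)) (J.map a a') ≫ lanRepUnit J b a' =
      lanRepUnit J b a ▷ (a ⟶[V] a') ≫ (lanRep J b (J.obj a)) ◁ J.map a a' ≫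
        lanRepRight J b (J.obj a) (J.obj a') := by
  rw [← whisker_exchange_assoc, lanRepUnit_right, lanRepUnit, rightUnitor_inv_naturality_assoc,
    ← whisker_exchange_assoc, lanRepι_condition, associator_naturality_right_assoc,
    ← MonoidalCategory.whiskerLeft_comp_assoc, ← gcomp_precomp_right, Category.comp_id,
    gcomp_eId_right]
  simp

theorem lanRepCounit_right (b x y : B) :
    lanRepRight J b x y ≫ lanRepCounit J b y =
      lanRepCounit J b x ▷ (x ⟶[V] y) ≫ eComp V b x y := by
  apply lanRep_hom_ext_right
  intro a
  rw [reassoc_of% lanRepι_right J b x y a, lanRepι_counit,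
    ← MonoidalCategory.comp_whiskerRight_assoc, lanRepι_counit, ← e_assoc, Iso.hom_inv_id_assoc]

variable [HasLimits V]

/-- The left action of `B` on `∫ᵃ B(b, J a) ⊗ B(J a, x)`, composition on the left factor. -/
def lanRepLeft (b' b x : B) : (b' ⟶[V] b) ⊗ lanRep J b x ⟶ lanRep J b' x :=
  (β_ _ _).hom ≫
    unc ((repMap b b' ≫ J.restrict (VFun.rep b) (VFun.rep b')) ≫ cur (lanNat J _ _ x))

theorem lanRepι_left (b' b x : B) (a : A) :
    (b' ⟶[V] b) ◁ lanRepι J b x a ≫ lanRepLeft J b' b x =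
      (α_ _ _ _).inv ≫ eComp V b' b (J.obj a) ▷ (J.obj a ⟶[V] x) ≫ lanRepι J b' x a := by
  have h : (b ⟶[V] J.obj a) ◁ (repMap b b' ≫ J.restrict (VFun.rep (V := V) b) (VFun.rep b')) ≫
      unc (VFun.ev (J.comp (VFun.rep (V := V) b)) (J.comp (VFun.rep b')) a) =
        (β_ _ _).hom ≫ eComp V b' b (J.obj a) := by
    rw [← unc_precomp, Category.assoc, restrict_ev, unc_repMap_ev]
  rw [lanRepLeft, unc_precomp, unc_cur, braiding_naturality_right_assoc, lanRepι,
    ← whisker_exchange_assoc, ι_lanNat]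
  exact braiding_move _ _ _ h _

theorem lanRepUnit_left (b' b : B) (a : A) :
    (b' ⟶[V] b) ◁ lanRepUnit J b a ≫ lanRepLeft J b' b (J.obj a) =
      eComp V b' b (J.obj a) ≫ lanRepUnit J b' a := by
  simp only [lanRepUnit, MonoidalCategory.whiskerLeft_comp, Category.assoc, lanRepι_left,
    associator_inv_naturality_right_assoc]
  rw [rightUnitor_inv_naturality_assoc, whisker_exchange_assoc]
  simp

theorem lanRepCounit_left (b' b x : B) :
    lanRepLeft J b' b x ≫ lanRepCounit J b' x =
      (b' ⟶[V] b) ◁ lanRepCounit J b x ≫ eComp V b' b x := by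
  apply lanRep_hom_ext_left
  intro a
  rw [reassoc_of% lanRepι_left J b' b x a, lanRepι_counit,
    ← MonoidalCategory.whiskerLeft_comp_assoc, lanRepι_counit, e_assoc]

/-- An isomorphism of `B`-bimodules `∫ᵃ B(b, J a) ⊗ B(J a, x) ≅ B(b, x)`: isomorphisms compatible
with both actions of `B`. -/
structure LanRepIso where
  /-- the isomorphisms -/
  iso (b x : B) : lanRep J b x ≅ (b ⟶[V] x)
  right (b x y : B) : lanRepRight J b x y ≫ (iso b y).hom =
    (iso b x).hom ▷ (x ⟶[V] y) ≫ eComp V b x y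
  left (b' b x : B) : lanRepLeft J b' b x ≫ (iso b' x).hom =
    (b' ⟶[V] b) ◁ (iso b x).hom ≫ eComp V b' b x

/-- A `V`-natural isomorphism `Lan_J B(b, J-) ≅ B(b, -)` of `V`-functors `Bᵒᵖ ⥤ V-Cat[B, V]` is the
same as an isomorphism of `B`-bimodules. -/
theorem nonempty_lanRepIso_iff : Nonempty (LanRepIso J) ↔
    Nonempty ((VFun.yoneda V B).comp ((J.vPrecomp V).comp J.lan) ≅ VFun.yoneda V B) := by
  have hright : ∀ b x y : B,
      ((((VFun.yoneda V B).comp ((J.vPrecomp V).comp J.lan)).obj (Opposite.op b)).act x y) =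
        lanRepRight J b x y := fun b x y => unc_cur _
  have hleft : ∀ b' b x : B,
      (((VFun.yoneda V B).comp ((J.vPrecomp V).comp J.lan)).comp (VFun.evalFun V x)).act
        (Opposite.op b) (Opposite.op b') = (β_ _ _).hom ≫ lanRepLeft J b' b x := by
    intro b' b x
    rw [lanRepLeft, SymmetricCategory.symmetry_assoc, Category.assoc]
    have : J.lan.map (J.comp (VFun.rep b)) (J.comp (VFun.rep b')) ≫
        VFun.ev (lanFun J (J.comp (VFun.rep b))) (lanFun J (J.comp (VFun.rep b'))) x =
          cur (lanNat J _ _ x) :=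
      VFun.lift_ev (F := lanFun J (J.comp (VFun.rep b))) (G := lanFun J (J.comp (VFun.rep b'))) _
        (isVWedge_lanNat J (J.comp (VFun.rep b)) (J.comp (VFun.rep b'))) x
    rw [← this]
    change unc ((_ ≫ _ ≫ _) ≫ _) = _
    simp only [Category.assoc]
    rfl
  constructor
  · rintro ⟨⟨φ, right, left⟩⟩
    refine nonempty_iso_of_components (fun d x => φ d.unop x) (fun d d' x => ?_) fun d x y => ?_
    · refine (congrArg (· ≫ (φ d'.unop x).hom) (hleft d'.unop d.unop x)).trans ?_
      refine Eq.trans ?_ (congrArg ((φ d.unop x).hom ▷ _ ≫ ·) (yoneda_act d.unop d'.unop x).symm)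
      have := left d'.unop d.unop x
      refine (Category.assoc _ _ _).trans ((congrArg ((β_ _ _).hom ≫ ·) this).trans ?_)
      exact (braiding_naturality_left_assoc (φ d.unop x).hom (d'.unop ⟶[V] d.unop) _).symm
    · refine (congrArg (· ≫ (φ d.unop y).hom) (hright d.unop x y)).trans ?_
      refine Eq.trans ?_ (congrArg ((φ d.unop x).hom ▷ _ ≫ ·) (rep_act d.unop x y).symm)
      exact right d.unop x y
  · rintro ⟨e⟩
    refine ⟨⟨fun b x => ⟨component₂ e.hom (Opposite.op b) x, component₂ e.inv (Opposite.op b) x,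
      ?_, ?_⟩, fun b x y => ?_, fun b' b x => ?_⟩⟩
    · refine (component₂_comp e.hom e.inv _ _).symm.trans ?_
      rw [e.hom_inv_id]
      exact component₂_id _ _ _
    · refine (component₂_comp e.inv e.hom _ _).symm.trans ?_
      rw [e.inv_hom_id]
      exact component₂_id _ _ _
    · have h := component₂_right e.hom (Opposite.op b) x y
      rw [hright] at h
      exact h.trans (congrArg _ (rep_act b x y))
    · have h := component₂_left e.hom (Opposite.op b) (Opposite.op b') x
      rw [hleft, yoneda_act] at h
      have h' : (β_ (lanRep J b x) (b' ⟶[V] b)).hom ≫ lanRepLeft J b' b x ≫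
          component₂ e.hom (Opposite.op b') x =
            component₂ e.hom (Opposite.op b) x ▷ (b' ⟶[V] b) ≫ (β_ _ _).hom ≫ eComp V b' b x :=
        (Category.assoc _ _ _).symm.trans h
      rw [← cancel_epi (β_ (lanRep J b x) (b' ⟶[V] b)).hom]
      refine h'.trans (braiding_naturality_left_assoc _ _ _)

/-- If `V-Cat(J, V)` is fully faithful, composition `∫ᵃ B(b, J a) ⊗ B(J a, x) ⟶ B(b, x)` is
invertible: its inverse is the extension to `B` of the `V`-natural family `u ↦ [u, 1]`. -/
theorem nonempty_lanRepIso (full : (J.precomp V).Full)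
    (faithful : (J.precomp V).Faithful) : Nonempty (LanRepIso J) := by
  have hη : ∀ b a a', (J.comp (VFun.rep (V := V) b)).act a a' ≫ lanRepUnit J b a' =
      lanRepUnit J b a ▷ (a ⟶[V] a') ≫ (J.comp (lanFun J (J.comp (VFun.rep b)))).act a a' := by
    intro b a a'
    rw [comp_rep_act, lanRepUnit_condition, comp_act (F := lanFun J _)]
    congr 2
    exact (unc_cur _).symm
  have hσ : ∀ b, ∃ σ : VFun.rep (V := V) b ⟶ lanFun J (J.comp (VFun.rep b)),
      ∀ a, VFun.component σ (J.obj a) = lanRepUnit J b a := by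
    intro b
    obtain ⟨σ, hσ⟩ := full.map_surjective
      (show (J.precomp V).obj (VFun.rep b) ⟶ (J.precomp V).obj (lanFun J (J.comp (VFun.rep b))) from
        VFun.homMk (lanRepUnit J b) (hη b))
    exact ⟨σ, fun a => (congrArg (VFun.component · a) hσ).trans (VFun.component_homMk _ (hη b) a)⟩
  choose σ hσ using hσ
  -- It remains to see that composition is a two-sided inverse of `σ`.
  have hε : ∀ b x y, (lanFun J (J.comp (VFun.rep (V := V) b))).act x y ≫ lanRepCounit J b y =
      lanRepCounit J b x ▷ (x ⟶[V] y) ≫ (VFun.rep b).act x y := by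
    intro b x y
    rw [rep_act, ← lanRepCounit_right]
    exact congrArg (· ≫ lanRepCounit J b y) (unc_cur _)
  let ε (b : B) : lanFun J (J.comp (VFun.rep (V := V) b)) ⟶ VFun.rep b :=
    VFun.homMk (lanRepCounit J b) (hε b)
  have hσε : ∀ b, σ b ≫ ε b = 𝟙 _ := by
    intro b
    apply faithful.map_injective
    refine VFun.component_ext fun a => ?_
    change VFun.component (σ b ≫ ε b) (J.obj a) = VFun.component (𝟙 (VFun.rep b)) (J.obj a)
    rw [VFun.component_comp, hσ, VFun.component_homMk, lanRepUnit_counit, VFun.component_id]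
  refine ⟨⟨fun b x => ⟨lanRepCounit J b x, VFun.component (σ b) x, ?_, ?_⟩,
    lanRepCounit_right J, lanRepCounit_left J⟩⟩
  · apply lanRep_hom_ext
    intro a
    have h := VFun.component_naturality (σ b) (J.obj a) x
    rw [rep_act, hσ] at h
    rw [reassoc_of% lanRepι_counit J b x a, h, Category.comp_id, ← lanRepUnit_right]
    exact congrArg (_ ≫ ·) (unc_cur _)
  · rw [← VFun.component_id (VFun.rep b), ← hσε, VFun.component_comp, VFun.component_homMk]

end LanRep

/-! ### Extension of natural families along `J` -/

namespace LanRepIso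

variable {V : Type u} [Category.{w} V] [MonoidalCategory V] [SymmetricCategory V]
  [MonoidalClosed V] [HasLimits V] [HasColimits V]
variable {A B : Type w} [EnrichedCategory V A] [EnrichedCategory V B] {J : VFun V A B}
  (e : LanRepIso J) {C : Type u₂} [EnrichedCategory V C]

/-- The map `B(b, J a) ⟶ B(b, J a)`, `u ↦ φ[u, 1]`, of an isomorphism `φ` of bimodules. -/
def twist (b : B) (a : A) : (b ⟶[V] J.obj a) ⟶ (b ⟶[V] J.obj a) :=
  lanRepUnit J b a ≫ (e.iso b (J.obj a)).hom

/-- An isomorphism of bimodules is determined by its twist: `φ[u, v] = v ∘ φ[u, 1]`. -/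
theorem ι_iso_hom (b x : B) (a : A) :
    lanRepι J b x a ≫ (e.iso b x).hom = gcomp V (e.twist b a) (𝟙 (J.obj a ⟶[V] x)) := by
  rw [← lanRepUnit_right, Category.assoc, e.right, ← MonoidalCategory.comp_whiskerRight_assoc,
    gcomp, tensorHom_id]
  rfl

/-- The twist commutes with precomposition by morphisms of `B`. -/
theorem twist_left (b' b : B) (a : A) :
    eComp V b' b (J.obj a) ≫ e.twist b' a = (b' ⟶[V] b) ◁ e.twist b a ≫ eComp V b' b (J.obj a) := by
  rw [twist, ← reassoc_of% lanRepUnit_left J b' b a, e.left, twist,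
    MonoidalCategory.whiskerLeft_comp_assoc]

/-- The twist is `V`-natural in `a`. -/
theorem twist_condition (b : B) (a a' : A) :
    gcomp V (𝟙 (b ⟶[V] J.obj a)) (J.map a a') ≫ e.twist b a' =
      gcomp V (e.twist b a) (J.map a a') := by
  rw [twist, reassoc_of% lanRepUnit_condition J b a a', e.right, whisker_exchange_assoc,
    ← MonoidalCategory.comp_whiskerRight_assoc, gcomp, MonoidalCategory.tensorHom_def,
    Category.assoc]
  rfl

theorem inv_right (b x y : B) :
    eComp V b x y ≫ (e.iso b y).inv = (e.iso b x).inv ▷ (x ⟶[V] y) ≫ lanRepRight J b x y := by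
  rw [Iso.comp_inv_eq, Category.assoc, e.right, ← MonoidalCategory.comp_whiskerRight_assoc,
    Iso.inv_hom_id, MonoidalCategory.id_whiskerRight, Category.id_comp]

theorem inv_left (b' b x : B) :
    eComp V b' b x ≫ (e.iso b' x).inv = (b' ⟶[V] b) ◁ (e.iso b x).inv ≫ lanRepLeft J b' b x := by
  rw [Iso.comp_inv_eq, Category.assoc, e.left, ← MonoidalCategory.whiskerLeft_comp_assoc,
    Iso.inv_hom_id, MonoidalCategory.whiskerLeft_id, Category.id_comp]

/-- The twist is invertible. Composing the inverse of `φ` with composition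
`∫ᵃ B(b, J a) ⊗ B(J a, x) ⟶ B(b, x)` gives endomorphisms `s` of `B(b, x)`. As `[u, 1]` is sent to
`u` by composition, `s` is a left inverse of the twist. Being compatible with the right action, `s`
is composition with an element of `B(b, b)`; it therefore commutes with the twist, which is
compatible with the left action. -/
instance isIso_twist (b : B) (a : A) : IsIso (e.twist b a) := by
  let s (x : B) : (b ⟶[V] x) ⟶ (b ⟶[V] x) := (e.iso b x).inv ≫ lanRepCounit J b x
  have hs : ∀ x, s x = (λ_ _).inv ≫ (eId V b ≫ s b) ▷ (b ⟶[V] x) ≫ eComp V b b x := by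
    intro x
    rw [MonoidalCategory.comp_whiskerRight_assoc, MonoidalCategory.comp_whiskerRight_assoc,
      ← lanRepCounit_right, ← reassoc_of% e.inv_right b b x, e_id_comp_assoc]
  -- `hs` says that `s` is composition with the image of the identity of `b`.
  have h₁ : e.twist b a ≫ s (J.obj a) = 𝟙 _ := by
    rw [twist, Category.assoc, Iso.hom_inv_id_assoc, lanRepUnit_counit]
  have h₂ : s (J.obj a) ≫ e.twist b a = e.twist b a ≫ s (J.obj a) := by
    rw [hs, Category.assoc, Category.assoc, e.twist_left, ← whisker_exchange_assoc,
      leftUnitor_inv_naturality_assoc]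
  exact ⟨s (J.obj a), h₁, h₂.trans h₁⟩

/-- A `V`-natural family `g` on `B` is determined by its restriction along `J`: on a generator
`[u, v]`, the morphism `g_x ∘ F(φ[u, v])` equals `G v ∘ g_{J a} ∘ F(φ[u, 1])`, and `φ` is
invertible. -/
theorem wedge_ext (e : LanRepIso J) {F G : VFun V B C} {X : V}
    {g g' : ∀ b, X ⟶ (F.obj b ⟶[V] G.obj b)}
    (hg : IsVWedge F G g) (hg' : IsVWedge F G g') (h : ∀ a, g (J.obj a) = g' (J.obj a)) :
    g = g' := by
  have key : ∀ {g : ∀ b, X ⟶ (F.obj b ⟶[V] G.obj b)} (_ : IsVWedge F G g) (b x : B) (a : A),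
      lanRepι J b x a ▷ X ≫ (e.iso b x).hom ▷ X ≫ gcomp V (F.map b x) (g x) =
        (α_ _ _ _).hom ≫ gcomp V (e.twist b a ≫ F.map _ _)
          ((β_ _ _).hom ≫ gcomp V (g (J.obj a)) (G.map (J.obj a) x)) := by
    intro g hg b x a
    rw [← gcomp_precomp_left, ← gcomp_precomp_left, reassoc_of% e.ι_iso_hom b x a,
      VFun.gcomp_map, gcomp_assoc, Category.id_comp, hg]
  funext b
  have h₁ : gcomp V (F.map b b) (g b) = gcomp V (F.map b b) (g' b) := by
    rw [← cancel_epi ((e.iso b b).hom ▷ X)]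
    apply lanRep_hom_ext_right
    intro a
    rw [key hg, key hg', h]
  have h₂ := congrArg (fun t => (λ_ X).inv ≫ eId V b ▷ X ≫ t) h₁
  simpa [← gcomp_precomp_left, gcomp_eId_left] using h₂

variable {F G : VFun V B C} {X : V}
  {f : ∀ a, X ⟶ (F.obj (J.obj a) ⟶[V] G.obj (J.obj a))} (hf : IsVWedge (J.comp F) (J.comp G) f)

/-- The map `(∫ᵃ B(b, J a) ⊗ B(J a, x)) ⊗ X ⟶ C(F b, G x)`, `[u, v] ⊗ s ↦ G v ∘ f(s) ∘ F u'`,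
given by a `V`-natural family `f` on `A`, where `u'` is `φ[u, 1]`. -/
def bind (b x : B) : lanRep J b x ⊗ X ⟶ (F.obj b ⟶[V] G.obj x) :=
  lanObj.desc (fun a => (α_ _ _ _).hom ≫ gcomp V (e.twist b a ≫ F.map _ _)
    ((β_ _ _).hom ≫ gcomp V (f a) (G.map (J.obj a) x))) fun a a' => by
    rw [comp_rep_act]
    have h : gcomp V (J.map a a' ≫ F.map _ _)
        ((β_ (J.obj a' ⟶[V] x) X).hom ≫ gcomp V (f a') (G.map (J.obj a') x)) =
      (α_ _ _ _).inv ≫ gcomp V (J.map a a') (𝟙 (J.obj a' ⟶[V] x)) ▷ X ≫ (β_ _ _).hom ≫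
        gcomp V (f a) (G.map (J.obj a) x) := by
      have hfa : gcomp V (J.map a a' ≫ F.map _ _) (f a') =
        (β_ (a ⟶[V] a') X).hom ≫ gcomp V (f a) (J.map a a' ≫ G.map _ _) := hf a a'
      rw [gcomp_precomp_right, gcomp_assoc', hfa, gcomp_precomp_left, gcomp_assoc,
        braiding_naturality_left_assoc, ← gcomp_precomp_right, VFun.gcomp_map, Category.id_comp]
      simp [braiding_tensor_left_hom]
    rw [associator_naturality_left_assoc, ← gcomp_precomp_left,
      reassoc_of% e.twist_condition b a a', VFun.gcomp_map, gcomp_assoc, h, gcomp_precomp_right]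
    simp only [gcomp_precomp_right]
    simp

theorem ι_bind (b x : B) (a : A) :
    lanRepι J b x a ▷ X ≫ e.bind hf b x = (α_ _ _ _).hom ≫ gcomp V (e.twist b a ≫ F.map _ _)
      ((β_ _ _).hom ≫ gcomp V (f a) (G.map (J.obj a) x)) :=
  lanObj.ι_desc _ _ a

theorem bind_left (b' b x : B) :
    lanRepLeft J b' b x ▷ X ≫ e.bind hf b' x =
      (α_ _ _ _).hom ≫ gcomp V (F.map b' b) (e.bind hf b x) := by
  apply lanRep_hom_ext_middle
  intro a
  rw [← MonoidalCategory.comp_whiskerRight_assoc, lanRepι_left,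
    associator_naturality_middle_assoc, ← gcomp_precomp_right, ι_bind]
  simp only [MonoidalCategory.comp_whiskerRight, Category.assoc, ι_bind]
  rw [associator_naturality_left_assoc, ← gcomp_precomp_left,
    reassoc_of% e.twist_left b' b a, ← eComp_eq_gcomp, VFun.gcomp_map, Category.id_comp,
    Category.id_comp, ← gcomp_precomp_right, gcomp_assoc]
  simp only [gcomp_precomp_right]
  simp

theorem bind_right (b x y : B) :
    lanRepRight J b x y ▷ X ≫ e.bind hf b y =
      (α_ _ _ _).hom ≫ _ ◁ (β_ _ _).hom ≫ (α_ _ _ _).inv ≫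
        gcomp V (e.bind hf b x) (G.map x y) := by
  apply lanRep_hom_ext_right₂
  intro a
  rw [← MonoidalCategory.comp_whiskerRight_assoc, lanRepι_right, associator_naturality_left_assoc,
    ← whisker_exchange_assoc, associator_inv_naturality_left_assoc, ← gcomp_precomp_left, ι_bind]
  simp only [MonoidalCategory.comp_whiskerRight, Category.assoc, ι_bind]
  have h : eComp V (J.obj a) x y ▷ X ≫ (β_ (J.obj a ⟶[V] y) X).hom ≫
      gcomp V (f a) (G.map (J.obj a) y) = (β_ _ _).hom ≫ (α_ _ _ _).inv ≫
        gcomp V (gcomp V (f a) (G.map (J.obj a) x)) (G.map x y) := by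
    rw [braiding_naturality_left_assoc, ← gcomp_precomp_right, ← eComp_eq_gcomp,
      VFun.gcomp_map, Category.id_comp, Category.id_comp, gcomp_assoc']
  rw [associator_naturality_middle_assoc, ← gcomp_precomp_right, h]
  simp only [gcomp_precomp_left, gcomp_precomp_right, gcomp_assoc]
  simp [braiding_tensor_left_hom]

/-- The extension of a `V`-natural family on `A` to `B`. -/
def extend (b : B) : X ⟶ (F.obj b ⟶[V] G.obj b) :=
  (λ_ X).inv ≫ eId V b ▷ X ≫ (e.iso b b).inv ▷ X ≫ e.bind hf b b

/-- Composition of the extended family with `F` is `bind`, transported along `φ`. -/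
theorem map_extend (b x : B) :
    gcomp V (F.map b x) (e.extend hf x) = (e.iso b x).inv ▷ X ≫ e.bind hf b x := by
  have h : gcomp V (F.map b x) ((e.iso x x).inv ▷ X ≫ e.bind hf x x) =
      (α_ _ _ _).inv ≫ (eComp V b x x ≫ (e.iso b x).inv) ▷ X ≫ e.bind hf b x := by
    rw [e.inv_left, MonoidalCategory.comp_whiskerRight_assoc, bind_left, gcomp_precomp_right]
    simp
  rw [extend, gcomp_precomp_right, gcomp_precomp_right, h]
  simp only [MonoidalCategory.comp_whiskerRight, Category.assoc,
    associator_inv_naturality_middle_assoc]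
  have h' : ((b ⟶[V] x) ◁ eId V x) ▷ X ≫ eComp V b x x ▷ X = (ρ_ _).hom ▷ X := by
    rw [← MonoidalCategory.comp_whiskerRight, ← cancel_epi ((ρ_ _).inv ▷ X),
      ← MonoidalCategory.comp_whiskerRight, e_comp_id]
    simp
  rw [reassoc_of% h']
  simp

/-- Composition of the extended family with `G` is also `bind`, transported along `φ`. -/
theorem extend_map (b x : B) :
    (β_ (b ⟶[V] x) X).hom ≫ gcomp V (e.extend hf b) (G.map b x) =
      (e.iso b x).inv ▷ X ≫ e.bind hf b x := by
  have h : gcomp V ((e.iso b b).inv ▷ X ≫ e.bind hf b b) (G.map b x) =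
      (α_ _ _ _).hom ≫ _ ◁ (β_ _ _).hom ≫ (α_ _ _ _).inv ≫
      (eComp V b b x ≫ (e.iso b x).inv) ▷ X ≫ e.bind hf b x := by
    rw [e.inv_right, MonoidalCategory.comp_whiskerRight_assoc, bind_right, gcomp_precomp_left,
      associator_naturality_left_assoc, ← whisker_exchange_assoc,
      associator_inv_naturality_left_assoc, Iso.inv_hom_id_assoc,
      ← MonoidalCategory.whiskerLeft_comp_assoc, SymmetricCategory.symmetry]
    simp
  rw [extend, gcomp_precomp_left, gcomp_precomp_left, h]
  have h' : eId V b ▷ (b ⟶[V] x) ▷ X ≫ eComp V b b x ▷ X = (λ_ _).hom ▷ X := by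
    rw [← MonoidalCategory.comp_whiskerRight, ← cancel_epi ((λ_ _).inv ▷ X),
      ← MonoidalCategory.comp_whiskerRight, e_id_comp]
    simp
  rw [associator_naturality_left_assoc, ← whisker_exchange_assoc,
    associator_inv_naturality_left_assoc, MonoidalCategory.comp_whiskerRight_assoc,
    reassoc_of% h']
  simp

theorem isVWedge_extend : IsVWedge F G (e.extend hf) := fun b x =>
  (e.map_extend hf b x).trans (e.extend_map hf b x).symm

/-- The extended family restricts to the given one. After composition with `F`, both agree on the
image of the twist, which is invertible. -/
theorem extend_obj (a : A) : e.extend hf (J.obj a) = f a := by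
  have h₁ : gcomp V (F.map (J.obj a) (J.obj a)) (e.extend hf (J.obj a)) =
      gcomp V (F.map (J.obj a) (J.obj a)) (f a) := by
    have ht : e.twist (J.obj a) a ▷ X ≫ (e.iso (J.obj a) (J.obj a)).inv ▷ X =
        lanRepUnit J (J.obj a) a ▷ X := by
      rw [← MonoidalCategory.comp_whiskerRight, twist, Category.assoc, Iso.hom_inv_id,
        Category.comp_id]
    rw [← cancel_epi (e.twist (J.obj a) a ▷ X), map_extend, ← gcomp_precomp_left, reassoc_of% ht,
      lanRepUnit]
    simp only [MonoidalCategory.comp_whiskerRight, Category.assoc, ι_bind]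
    rw [associator_naturality_middle_assoc, ← gcomp_precomp_right, braiding_naturality_left_assoc,
      ← gcomp_precomp_right, G.map_id, gcomp_eId_right]
    simp [gcomp_precomp_right]
  have h₂ := congrArg (fun t => (λ_ X).inv ≫ eId V (J.obj a) ▷ X ≫ t) h₁
  simpa [← gcomp_precomp_left, gcomp_eId_left] using h₂

/-- If `Lan_J B(b, J-) ≅ B(b, -)`, then `V`-natural families on `A` extend uniquely to `B`, so that
`V-Cat[J, C]` is `V`-fully faithful for every `V`-category `C`. -/
theorem vPrecomp_fullyFaithful (e : LanRepIso J) (C : Type u₂)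
    [EnrichedCategory V C] : (J.vPrecomp C).IsVFullyFaithful := by
  intro F G
  have hf := VFun.isVWedge_ev (J.comp F) (J.comp G)
  have hinv : ∀ b, VFun.lift (e.extend (F := F) (G := G) hf) (e.isVWedge_extend hf) ≫
      VFun.ev F G b = e.extend (F := F) (G := G) hf b := VFun.lift_ev _ _
  refine ⟨VFun.lift (e.extend (F := F) (G := G) hf) (e.isVWedge_extend hf), ?_, ?_⟩
  · apply VFun.vHom_ext
    intro b
    rw [Category.id_comp]
    refine congrFun (e.wedge_ext
      (g := fun b => (J.restrict F G ≫ VFun.lift _ (e.isVWedge_extend hf)) ≫ VFun.ev F G b)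
      ((VFun.isVWedge_ev F G).comp_left _) (VFun.isVWedge_ev F G) fun a => ?_) b
    rw [Category.assoc, hinv, extend_obj, restrict_ev]
  · apply VFun.vHom_ext
    intro a
    refine (Category.assoc _ _ _).trans ((congrArg (_ ≫ ·) (J.restrict_ev F G a)).trans ?_)
    exact (hinv _).trans ((e.extend_obj hf a).trans (Category.id_comp _).symm)

end LanRepIso

end VFun

end EnrichedLaxEpi

end

theorem theorem5 {V : Type u} [Category.{w} V] [MonoidalCategory V] [SymmetricCategory V]
    [MonoidalClosed V] [HasLimits V] [HasColimits V]
    {A B : Type w} [EnrichedCategory V A] [EnrichedCategory V B] (J : EnrichedLaxEpi.VFun V A B) :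
    List.TFAE [
      J.IsVLaxEpi,
      EnrichedLaxEpi.IsLaxEpi J.toCell,
      (J.precomp V).Full ∧ (J.precomp V).Faithful,
      (J.vPrecomp V).IsVFullyFaithful,
      Nonempty ((EnrichedLaxEpi.VFun.yoneda V B).comp ((J.vPrecomp V).comp J.lan) ≅
        EnrichedLaxEpi.VFun.yoneda V B),
      ∀ (C : Type (max w u₃)) [EnrichedCategory V C], (J.vPrecomp C).IsVFullyFaithful] := by
  tfae_have 5 → 6 := by
    intro h C _
    obtain ⟨e⟩ := J.nonempty_lanRepIso_iff.2 h
    exact e.vPrecomp_fullyFaithful C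
  tfae_have 5 → 4 := by
    intro h
    obtain ⟨e⟩ := J.nonempty_lanRepIso_iff.2 h
    exact e.vPrecomp_fullyFaithful V
  tfae_have 6 → 1 := fun h C _ => J.isVFullyFaithful_vPrecomp_of_uLift (h _)
  tfae_have 1 → 2 := fun h C => J.precomp_full_faithful (h C.carrier)
  tfae_have 2 → 3 := fun h => J.precomp_full_faithful_of_small fun C _ =>
    h (EnrichedLaxEpi.VCat.of V C)
  tfae_have 4 → 3 := J.precomp_full_faithful
  tfae_have 3 → 5 := fun h => J.nonempty_lanRepIso_iff.1 (J.nonempty_lanRepIso h.1 h.2)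
  tfae_finish
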